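/- Let $p$ be a prime, $n\ge 1$, $q=p^n$, $G=\mathrm{GL}_3(\mathbb F_q)$, $\Gamma=\mathrm{GL}_3(\mathbb F_p)\le G$, and let $\rho=\mathrm{Ind}_\Gamma^G 1$ be the representation of $G$ by right translation, $(\rho(g)\phi)(x)=\phi(xg)$, on $\{\phi:G\to\mathbb C \mid \phi(\gamma x)=\phi(x)\ \text{for all } \gamma\in\Gamma,\ x\in G\}$. Let $\chi_\rho$ be its character. All finite fields $\mathbb F_{p^k}$ are taken inside one algebraic closure of $\mathbb F_q$, and $\mathbb 1_S$ denotes the indicator function of $S$. For an integer $Q\geq 2$ put $$H_{1,Q}=Q^2(Q^2+Q+1),\quad H_{2,Q}=Q^3(Q+1)(Q^2+Q+1),\quad P_{1,Q}=(Q^3-1)(Q+1),\quad P_{2,Q}=Q(Q^3-1)(Q^2-1),$$ $$P_{3,Q}=Q^2(Q^3-1)(Q+1),\quad E_{1,Q}=Q^3(Q^3-1),\quad E_{2,Q}=Q^3(Q-1)^2(Q+1).$$ Every element of $G$ is conjugate in $G$ (in the two elliptic cases: over the algebraic closure) to a matrix $\gamma$ of one of the following eight types. Its conjugacy class in $G$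 has $1$ element in the central case, and $H_{1,q},H_{2,q},P_{1,q},P_{2,q},P_{3,q},E_{1,q},E_{2,q}$ elements respectively in the other cases. The value of $\chi_\rho$ on this class is as follows. 1. Central: $\gamma=\mathrm{diag}(a,a,a)$, $a\in\mathbb F_q^\times$: $\ \chi_\rho=\frac{|G|}{|\Gamma|}\mathbb 1_{\mathbb F_p}(a)$. 2. First hyperbolic: $\gamma=\mathrm{diag}(a,a,b)$, $a\ne b$ in $\mathbb F_q^\times$: $\ \chi_\rho=\frac{|G|}{|\Gamma|}\frac{H_{1,p}}{H_{1,q}}\mathbb 1_{\Gamma}(\gamma)$. 3. Second hyperbolic: $\gamma=\mathrm{diag}(a,b,c)$, $a,b,c\in\mathbb F_q^\times$ distinct: $$\chi_\rho=\frac{|G|}{|\Gamma|\,H_{2,q}}\bigl(E_{2,p}\,\varepsilon_3(a,b,c)+E_{1,p}\,\varepsilon_2(a,b,c)+H_{2,p}\,\mathbb 1_\Gamma(\gamma)\bigr),$$ where $\varepsilon_3(a,b,c)=1$ if some reordering of $(a,b,c)$ has the form $(x,x^p,x^{p^2})$ with $x\in\mathbb F_{p^3}\setminus\mathbb F_p$,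 and $\varepsilon_3(a,b,c)=0$ otherwise; and $\varepsilon_2(a,b,c)=1$ if some reordering of $(a,b,c)$ has the form $(x,x^p,y)$ with $x\in\mathbb F_{p^2}\setminus\mathbb F_p$ and $y\in\mathbb F_p$, and $\varepsilon_2(a,b,c)=0$ otherwise. 4. First parabolic: $\gamma=\begin{pmatrix}a&1&0\\0&a&0\\0&0&a\end{pmatrix}$, $a\in\mathbb F_q^\times$: $\ \chi_\rho=\frac{|G|}{|\Gamma|}\frac{P_{1,p}}{P_{1,q}}\mathbb 1_{\mathbb F_p}(a)$. 5. Second parabolic: $\gamma=\begin{pmatrix}a&1&0\\0&a&1\\0&0&a\end{pmatrix}$, $a\in\mathbb F_q^\times$: $\ \chi_\rho=\frac{|G|}{|\Gamma|}\frac{P_{2,p}}{P_{2,q}}\mathbb 1_{\mathbb F_p}(a)$. 6. Third parabolic: $\gamma=\begin{pmatrix}a&1&0\\0&a&0\\0&0&b\end{pmatrix}$, $a\neq b$ in $\mathbb F_q^\times$: $\ \chi_\rho=\frac{|G|}{|\Gamma|}\frac{P_{3,p}}{P_{3,q}}\mathbb 1_{\Gamma}(\gamma)$. 7. First elliptic: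 elements of $G$ conjugate over the algebraic closure to $\mathrm{diag}(w,w^q,r)$, $w\in\mathbb F_{q^2}\setminus\mathbb F_q$, $r\in\mathbb F_q^\times$: $\ \chi_\rho=0$ if $2\mid n$, and otherwise $\chi_\rho=\frac{|G|}{|\Gamma|}\frac{E_{1,p}}{E_{1,q}}\mathbb 1_{\mathbb F_{p^2}\setminus\mathbb F_p}(w)\,\mathbb 1_{\mathbb F_p}(r)$. 8. Second elliptic: elements of $G$ conjugate over the algebraic closure to $\mathrm{diag}(w,w^q,w^{q^2})$, $w\in\mathbb F_{q^3}\setminus\mathbb F_q$: $\ \chi_\rho=0$ if $3\mid n$, and otherwise $\chi_\rho=\frac{|G|}{|\Gamma|}\frac{E_{2,p}}{E_{2,q}}\mathbb 1_{\mathbb F_{p^3}\setminus\mathbb F_p}(w)$. -/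

import Mathlib

open Matrix

noncomputable section

namespace GL3Char

/-- The elements of `K` lying in the field with `p ^ k` elements, for a field `K` of characteristic
`p`: the solutions in `K` of `x ^ (p ^ k) = x`. If `K` is algebraically closed, this is the
subfield of `K` with `p ^ k` elements. -/
def Fpow (p k : ℕ) (K : Type*) [Field K] : Set K := {x | x ^ p ^ k = x}

/-- `Fpow p 1 K` is the prime field of `K`. -/
theorem Fpow_one (p : ℕ) [Fact p.Prime] (K : Type*) [Field K] [Algebra (ZMod p) K] :
    Fpow p 1 K = Set.range (algebraMap (ZMod p) K) := by
  have h := (Polynomial.splits_iff_card_roots.1 (GaloisField.splits_zmod_X_pow_sub_X p))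
  have hp : 1 < p := (Fact.out : p.Prime).one_lt
  ext x
  simp only [Fpow, pow_one, Set.mem_ofPred_eq, Set.mem_range]
  constructor
  · intro hx
    have h1 := (GaloisField.splits_zmod_X_pow_sub_X p).roots_map (algebraMap (ZMod p) K)
    have h2 : x ∈ ((Polynomial.X ^ p - Polynomial.X : Polynomial (ZMod p)).map
        (algebraMap (ZMod p) K)).roots := by
      rw [Polynomial.mem_roots']
      refine ⟨?_, by simp [hx]⟩
      simpa using FiniteField.X_pow_card_sub_X_ne_zero K hp
    rw [h1, Multiset.mem_map] at h2
    obtain ⟨y, _, hy⟩ := h2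
    exact ⟨y, hy⟩
  · rintro ⟨y, rfl⟩
    rw [← map_pow, ZMod.pow_card]

/-- Over an algebraically closed field of characteristic `p`, `Fpow p k` has `p ^ k` elements. -/
theorem natCard_Fpow (p k : ℕ) [Fact p.Prime] (hk : k ≠ 0) (K : Type*) [Field K] [IsAlgClosed K]
    [CharP K p] : Nat.card (Fpow p k K) = p ^ k := by
  have hp : 1 < p := (Fact.out : p.Prime).one_lt
  have hne := FiniteField.X_pow_card_pow_sub_X_ne_zero K hk hp
  have h := Polynomial.card_rootSet_eq_natDegree (K := K)
    (galois_poly_separable (K := K) p (p ^ k) (dvd_pow_self p hk)) (IsAlgClosed.splits _)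
  rw [FiniteField.X_pow_card_pow_sub_X_natDegree_eq K hk hp] at h
  rw [← h, ← Nat.card_eq_fintype_card]
  congr 2
  ext x
  rw [Polynomial.mem_rootSet_of_ne hne]
  simp [Fpow, sub_eq_zero]

/-- `G = GL₃(K)`. -/
abbrev GL3 (K : Type*) [Field K] := GL (Fin 3) K

/-- The diagonal matrix with diagonal entries `d 0`, `d 1`, `d 2`. -/
def diag3 {K : Type*} [Field K] (d : Fin 3 → Kˣ) : GL3 K :=
  GeneralLinearGroup.mkOfDetNeZero (Matrix.diagonal fun i => (d i : K)) (by
    simp [Matrix.det_diagonal, Finset.prod_ne_zero_iff])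

/-- The matrix with rows `(a, 1, 0)`, `(0, a, 0)`, `(0, 0, b)`. -/
def jordan21 {K : Type*} [Field K] (a b : Kˣ) : GL3 K :=
  GeneralLinearGroup.mkOfDetNeZero !![(a : K), 1, 0; 0, a, 0; 0, 0, b] (by
    simp [Matrix.det_fin_three])

/-- The matrix with rows `(a, 1, 0)`, `(0, a, 1)`, `(0, 0, a)`. -/
def jordan3 {K : Type*} [Field K] (a : Kˣ) : GL3 K :=
  GeneralLinearGroup.mkOfDetNeZero !![(a : K), 1, 0; 0, a, 1; 0, 0, a] (by
    simp [Matrix.det_fin_three])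

/-- `Γ = GL₃(𝔽_p)` as a subgroup of `GL₃(F)`. -/
def Gam (p : ℕ) [Fact p.Prime] (F : Type*) [Field F] [Algebra (ZMod p) F] : Subgroup (GL3 F) :=
  (GeneralLinearGroup.map (n := Fin 3) (algebraMap (ZMod p) F)).range

/-- The induced representation `Ind_Γ^G 1`, in its usual model: `G` acts by right translation,
`(ρ(g) φ)(x) = φ(x g)`, on the space of functions `φ : G → ℂ` with `φ(γ x) = φ(x)` for all `γ ∈ Γ`
and `x ∈ G`. (For finite groups induction and coinduction are the same functor; the model by
equivariant functions is called `coind` in Mathlib.) -/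
def indOne {G : Type*} [Group G] (Γ : Subgroup G) :
    Representation ℂ G
      (Representation.coindV Γ.subtype (Representation.trivial ℂ Γ ℂ)) :=
  Representation.coind Γ.subtype (Representation.trivial ℂ Γ ℂ)

theorem mem_indOne_space {G : Type*} [Group G] (Γ : Subgroup G) (φ : G → ℂ) :
    φ ∈ Representation.coindV Γ.subtype (Representation.trivial ℂ Γ ℂ) ↔
      ∀ γ : Γ, ∀ x : G, φ (γ * x) = φ x := by
  simp

theorem indOne_apply {G : Type*} [Group G] (Γ : Subgroup G) (g x : G)
    (φ : Representation.coindV Γ.subtype (Representation.trivial ℂ Γ ℂ)) :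
    (indOne Γ g φ).1 x = φ.1 (x * g) := rfl

/-- The indicator function of a set, with complex values. -/
def ind {X : Type*} (S : Set X) : X → ℂ := S.indicator 1

/-- The size of a first hyperbolic class of `GL₃(𝔽_q)`. -/
def sizeH1 (q : ℕ) : ℕ := q ^ 2 * (q ^ 2 + q + 1)
/-- The size of a second hyperbolic class of `GL₃(𝔽_q)`. -/
def sizeH2 (q : ℕ) : ℕ := q ^ 3 * (q + 1) * (q ^ 2 + q + 1)
/-- The size of a first parabolic class of `GL₃(𝔽_q)`. -/
def sizeP1 (q : ℕ) : ℕ := (q ^ 3 - 1) * (q + 1)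
/-- The size of a second parabolic class of `GL₃(𝔽_q)`. -/
def sizeP2 (q : ℕ) : ℕ := q * (q ^ 3 - 1) * (q ^ 2 - 1)
/-- The size of a third parabolic class of `GL₃(𝔽_q)`. -/
def sizeP3 (q : ℕ) : ℕ := q ^ 2 * (q ^ 3 - 1) * (q + 1)
/-- The size of a first elliptic class of `GL₃(𝔽_q)`. -/
def sizeE1 (q : ℕ) : ℕ := q ^ 3 * (q ^ 3 - 1)
/-- The size of a second elliptic class of `GL₃(𝔽_q)`. -/
def sizeE2 (q : ℕ) : ℕ := q ^ 3 * (q - 1) ^ 2 * (q + 1)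

/-- The number of elements of the conjugacy class of `γ`. -/
def classSize {G : Type*} [Group G] (γ : G) : ℕ := Nat.card (conjugatesOf γ)

/-- The triples which, in a suitable order, have the form `(x, x ^ p, x ^ (p ^ 2))` with `x` in
`𝔽_{p³} ∖ 𝔽_p`: three Galois conjugates in `𝔽_{p³}/𝔽_p`. -/
def cubicConj (p : ℕ) (F : Type*) [Field F] : Set (Fin 3 → Fˣ) :=
  {d | ∃ σ : Equiv.Perm (Fin 3), (d (σ 0) : F) ∈ Fpow p 3 F \ Fpow p 1 F ∧
    d (σ 1) = d (σ 0) ^ p ∧ d (σ 2) = d (σ 0) ^ p ^ 2}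

/-- The triples which, in a suitable order, have the form `(x, x ^ p, y)` with `x` in
`𝔽_{p²} ∖ 𝔽_p` and `y` in `𝔽_p`: two Galois conjugates in `𝔽_{p²}/𝔽_p`, and an element
of `𝔽_p`. -/
def quadConj (p : ℕ) (F : Type*) [Field F] : Set (Fin 3 → Fˣ) :=
  {d | ∃ σ : Equiv.Perm (Fin 3), (d (σ 0) : F) ∈ Fpow p 2 F \ Fpow p 1 F ∧
    d (σ 1) = d (σ 0) ^ p ∧ (d (σ 2) : F) ∈ Fpow p 1 F}

/-- `γ ∈ GL₃(F)`, `|F| = p ^ n = q`, belongs to the first elliptic class with parameters `w`, `r`: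
`w` lies in `𝔽_{q²} ∖ 𝔽_q`, `r` in `𝔽_q^×`, and `γ` is conjugate to `diag(w, w ^ q, r)` over an
algebraic closure of `F`. -/
def IsElliptic1 (p n : ℕ) {F : Type*} [Field F] (w : (AlgebraicClosure F)ˣ) (r : Fˣ)
    (γ : GL3 F) : Prop :=
  (w : AlgebraicClosure F) ∈
    Fpow p (2 * n) (AlgebraicClosure F) \ Fpow p n (AlgebraicClosure F) ∧
  IsConj (diag3 ![w, w ^ p ^ n, Units.map (algebraMap F (AlgebraicClosure F)) r])
    (GeneralLinearGroup.map (algebraMap F (AlgebraicClosure F)) γ)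

/-- `γ ∈ GL₃(F)`, `|F| = p ^ n = q`, belongs to the second elliptic class with parameter `w`:
`w` lies in `𝔽_{q³} ∖ 𝔽_q`, and `γ` is conjugate to `diag(w, w ^ q, w ^ (q ^ 2))` over an
algebraic closure of `F`. -/
def IsElliptic2 (p n : ℕ) {F : Type*} [Field F] (w : (AlgebraicClosure F)ˣ)
    (γ : GL3 F) : Prop :=
  (w : AlgebraicClosure F) ∈
    Fpow p (3 * n) (AlgebraicClosure F) \ Fpow p n (AlgebraicClosure F) ∧
  IsConj (diag3 ![w, w ^ p ^ n, w ^ (p ^ n) ^ 2])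
    (GeneralLinearGroup.map (algebraMap F (AlgebraicClosure F)) γ)

/-- `|G| / |Γ|` for `G = GL₃(F)` and `Γ = GL₃(𝔽_p)`. -/
def idx (p : ℕ) [Fact p.Prime] (F : Type*) [Field F] [Algebra (ZMod p) F] : ℂ :=
  (Nat.card (GL3 F) : ℂ) / (Nat.card (Gam p F) : ℂ)

/-- The character `χ_ρ` of `ρ = Ind_Γ^G 1`, for `G = GL₃(F)` and `Γ = GL₃(𝔽_p)`. -/
def chi (p : ℕ) [Fact p.Prime] (F : Type*) [Field F] [Algebra (ZMod p) F] (γ : GL3 F) : ℂ :=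
  (indOne (Gam p F)).character γ

end GL3Char

end

open GL3Char

/-! The Frobenius formula gives χ_ρ(γ) = #{x : xγx⁻¹ ∈ Γ} / |Γ|. Grouping the x by the value δ =
xγx⁻¹ makes each group a coset of the centralizer of γ, so χ_ρ(γ) is |G|/|Γ| times the proportion of
the class of γ that lies in Γ (`character_indOne`, `card_conj_mem`, `chi_eq`). Two matrices over 𝔽_p
that are conjugate over F are already conjugate over 𝔽_p (`isConj_of_isConj_mapGL`), so this part of
the class is empty or a single class of Γ. What remains is to compute class sizes over both fields
and to decide which classes of G meet Γ.

Both questions rest on one dichotomy for 3×3 matrices. A matrix with a cyclic vector is similar to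
the companion matrix of its characteristic polynomial, hence is determined by that polynomial up to
similarity. A matrix without one is similar to diag(a, a, b) or to a scalar plus a nilpotent of rank
one (`exists_standard_of_not_hasCyclicVector`). A cyclic class therefore meets Γ exactly when its
characteristic polynomial has coefficients in 𝔽_p, that is, when x ↦ x^p permutes the eigenvalues
with multiplicity (`cubic_pow_of_isConj_incl`, `exists_isConj_incl`). A repeated eigenvalue forces
all eigenvalues into 𝔽_p.

For three distinct eigenvalues in F, Frobenius acts as the identity, a transposition or a 3-cycle,
and the class in Γ is then second hyperbolic, first elliptic or second elliptic. For an elliptic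
class the q-power map already moves the eigenvalues and is the n-th power of the p-power map; this
excludes 2 ∣ n, respectively 3 ∣ n. Class sizes come from orbit–stabilizer and an explicit
parametrization of each centralizer. -/

noncomputable section

namespace GL3Char

section

/-! ### The induced character and the part of a class lying in Γ. -/

section InducedCharacter

variable {G : Type*} [Group G]

theorem classSize_mul_card_centralizer (g : G) :
    classSize g * Nat.card (Subgroup.centralizer {g}) = Nat.card G := by
  have h := Nat.card_congr
    (MulAction.orbitEquivQuotientStabilizer (ConjAct G) g)
  have h2 := Subgroup.card_eq_card_quotient_mul_card_subgroup (MulAction.stabilizer (ConjAct G) g)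
  have h3 : (MulAction.orbit (ConjAct G) g : Set G) = conjugatesOf g := by
    ext x
    rw [ConjAct.mem_orbit_conjAct, isConj_comm, conjugatesOf, Set.mem_ofPred_eq]
  rw [← h, h3] at h2
  rw [Subgroup.nat_card_centralizer_nat_card_stabilizer, classSize]
  exact h2.symm

theorem classSize_eq_of_isConj {g h : G} (hgh : IsConj g h) : classSize g = classSize h := by
  rw [classSize, classSize, IsConj.conjugatesOf_eq hgh]

theorem classSize_pos [Finite G] (g : G) : 0 < classSize g := by
  have : Nonempty (conjugatesOf g) := ⟨⟨g, mem_conjugatesOf_self⟩⟩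
  exact Nat.card_pos

/-- The Frobenius formula for the character of the representation induced from the trivial one. -/
theorem character_indOne [Finite G] (Γ : Subgroup G) (g : G) :
    (indOne Γ).character g = (Nat.card {x : G // x * g * x⁻¹ ∈ Γ} : ℂ) / Nat.card Γ := by
  classical
  have := Fintype.ofFinite G
  set V := Representation.coindV Γ.subtype (Representation.trivial ℂ Γ ℂ) with hV
  -- Translation by g followed by averaging over Γ: this sends every function into V and agrees with
  -- ρ(g) on V. Hence its trace on all functions is the character, and can be computed in the basis
  -- of delta functions.
  let f : (G → ℂ) →ₗ[ℂ] (G → ℂ) :=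
    (Nat.card Γ : ℂ)⁻¹ • ∑ γ : Γ, LinearMap.funLeft ℂ ℂ (fun x : G => γ * x * g)
  have hcard : (Nat.card Γ : ℂ) ≠ 0 := Nat.cast_ne_zero.2 Nat.card_pos.ne'
  have hf (φ : G → ℂ) (x : G) : f φ x = (Nat.card Γ : ℂ)⁻¹ * ∑ γ : Γ, φ (γ * x * g) := by
    simp [f, LinearMap.funLeft_apply]
  have hmem (φ : G → ℂ) : f φ ∈ V := by
    rw [hV, mem_indOne_space]
    intro γ x
    rw [hf, hf]
    congr 1
    refine Fintype.sum_equiv (Equiv.mulRight γ) _ _ fun δ => ?_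
    simp [mul_assoc]
  have htr := LinearMap.trace_restrict_eq_of_forall_mem V f hmem
  have hres : f.restrict (fun x _ => hmem x) = indOne Γ g := by
    refine LinearMap.ext fun φ => Subtype.ext (funext fun x => ?_)
    rw [indOne_apply, LinearMap.coe_restrict_apply, hf]
    have := (mem_indOne_space Γ _).1 φ.2
    simp only [mul_assoc, this]
    simp only [Finset.sum_const, Finset.card_univ, nsmul_eq_mul, ← Nat.card_eq_fintype_card]
    field_simp
  have h1 : (indOne Γ).character g = LinearMap.trace ℂ (G → ℂ) f := by
    rw [← htr]
    exact (congrArg _ hres).symm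
  rw [h1, LinearMap.trace_eq_matrix_trace ℂ (Pi.basisFun ℂ G), Matrix.trace]
  simp only [Matrix.diag_apply, LinearMap.toMatrix_apply, Pi.basisFun_repr, Pi.basisFun_apply, hf]
  rw [← Finset.mul_sum, div_eq_inv_mul]
  congr 1
  -- A diagonal entry receives a contribution only from γ = (x g x⁻¹)⁻¹, so from at most one element
  -- of Γ.
  have h2 (x : G) : ∑ γ : Γ, (Pi.single x (1 : ℂ) : G → ℂ) (γ * x * g) =
      if x * g * x⁻¹ ∈ Γ then 1 else 0 := by
    have h3 (γ : Γ) : (γ : G) * x * g = x ↔ (γ : G)⁻¹ = x * g * x⁻¹ := by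
      constructor
      · intro h
        rw [eq_mul_inv_iff_mul_eq, inv_mul_eq_iff_eq_mul, ← mul_assoc, h]
      · intro h
        rw [eq_mul_inv_iff_mul_eq, inv_mul_eq_iff_eq_mul, ← mul_assoc] at h
        exact h.symm
    simp only [Pi.single_apply, h3]
    split_ifs with hx
    · rw [Fintype.sum_eq_single ⟨(x * g * x⁻¹)⁻¹, inv_mem hx⟩]
      · simp
      · rintro ⟨γ, hγ⟩ hne
        rw [if_neg]
        rintro h
        exact hne (Subtype.ext (by simp [← h]))
    · refine Finset.sum_eq_zero fun γ _ => if_neg fun h => hx ?_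
      rw [← h]
      exact inv_mem γ.2
  simp only [h2, Nat.card_eq_fintype_card, Fintype.card_subtype, Finset.sum_boole]

/-- For each δ fix one `c δ` that conjugates g to it. All other conjugating elements are `c δ * z`
with z in the centralizer of g, so (δ, z) ↦ `c δ * z` is a bijection. -/
theorem card_conj_mem [Finite G] {H : Type*} [Group H] (i : H →* G) (hi : Function.Injective i)
    (g : G) :
    Nat.card {x : G // x * g * x⁻¹ ∈ i.range} =
      Nat.card {δ : H // IsConj g (i δ)} * Nat.card (Subgroup.centralizer {g}) := by
  classical
  have hc (δ : {δ : H // IsConj g (i δ)}) : ∃ c : G, c * g * c⁻¹ = i δ := isConj_iff.1 δ.2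
  choose c hc using hc
  rw [← Nat.card_prod]
  symm
  refine Nat.card_congr (Equiv.ofBijective (fun y : {δ : H // IsConj g (i δ)} ×
    Subgroup.centralizer {g} => ⟨c y.1 * y.2, ?_⟩) ⟨?_, ?_⟩)
  · have h := Subgroup.mem_centralizer_singleton_iff.1 y.2.2
    refine ⟨y.1, ?_⟩
    rw [← hc, mul_assoc (c y.1) y.2, h]
    group
  · rintro ⟨δ, z, hz⟩ ⟨δ', z', hz'⟩ h
    have h := congrArg Subtype.val h
    simp only at h
    rw [Subgroup.mem_centralizer_singleton_iff] at hz hz'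
    have key (δ : {δ : H // IsConj g (i δ)}) (z : G) (hz : z * g = g * z) :
        i δ = (c δ * z) * g * (c δ * z)⁻¹ := by
      rw [← hc, mul_assoc (c δ) z, hz]
      group
    have : δ = δ' := Subtype.ext (hi (by rw [key _ _ hz, key _ _ hz', h]))
    subst this
    simpa using h
  · rintro ⟨x, δ, hδ⟩
    have hconj : IsConj g (i δ) := isConj_iff.2 ⟨x, hδ.symm⟩
    refine ⟨⟨⟨δ, hconj⟩, (c ⟨δ, hconj⟩)⁻¹ * x, ?_⟩, ?_⟩
    · rw [Subgroup.mem_centralizer_singleton_iff]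
      have h1 := hc ⟨δ, hconj⟩
      simp only [hδ] at h1
      have h2 : g = (c ⟨δ, hconj⟩)⁻¹ * (x * g * x⁻¹) * c ⟨δ, hconj⟩ := by
        rw [← h1]; group
      generalize c ⟨δ, hconj⟩ = d at h2
      calc d⁻¹ * x * g = d⁻¹ * (x * g * x⁻¹) * d * (d⁻¹ * x) := by group
        _ = g * (d⁻¹ * x) := by rw [← h2]
    · simp

end InducedCharacter

variable (p : ℕ) [Fact p.Prime] (F : Type*) [Field F] [Algebra (ZMod p) F]

/-- The inclusion of `GL₃(𝔽_p)` in `GL₃(F)`. -/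
abbrev incl : GL3 (ZMod p) →* GL3 F := GeneralLinearGroup.map (algebraMap (ZMod p) F)

theorem incl_injective : Function.Injective (incl p F) := by
  intro A B h
  ext i j
  have := congrArg (fun M : GL3 F => M i j) h
  exact (algebraMap (ZMod p) F).injective this

variable {p F} [Finite F]

theorem chi_eq (γ : GL3 F) : chi p F γ =
    idx p F * ((Nat.card {δ : GL3 (ZMod p) // IsConj γ (incl p F δ)} : ℂ) / classSize γ) := by
  have h1 := card_conj_mem (incl p F) (incl_injective p F) γ
  have h2 := classSize_mul_card_centralizer γ
  have h3 : (classSize γ : ℂ) ≠ 0 := Nat.cast_ne_zero.2 (classSize_pos γ).ne'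
  rw [chi, character_indOne, idx, Gam]
  erw [h1]
  rw [← h2]
  push_cast
  field_simp

theorem chi_eq_zero {γ : GL3 F} (h : ∀ δ : GL3 (ZMod p), ¬ IsConj γ (incl p F δ)) :
    chi p F γ = 0 := by
  have : IsEmpty {δ : GL3 (ZMod p) // IsConj γ (incl p F δ)} := ⟨fun x => h _ x.2⟩
  rw [chi_eq, Nat.card_of_isEmpty]
  simp

/-- Descent of conjugacy, taken here as the hypothesis `hdesc`, makes the elements of Γ conjugate to
γ in G a single class of Γ. -/
theorem chi_eq_of_isConj (hdesc : ∀ δ δ' : GL3 (ZMod p),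
      IsConj (incl p F δ) (incl p F δ') → IsConj δ δ')
    {γ : GL3 F} {δ : GL3 (ZMod p)} (h : IsConj γ (incl p F δ)) :
    chi p F γ = idx p F * ((classSize δ : ℂ) / classSize γ) := by
  rw [chi_eq]
  congr 3
  refine Nat.card_congr (Equiv.subtypeEquivRight fun x => ?_)
  rw [conjugatesOf, Set.mem_ofPred_eq]
  exact ⟨fun hx => hdesc _ _ (h.symm.trans hx), fun hx => h.trans ((incl p F).map_isConj hx)⟩

end

section

/-! ### Cyclic vectors, companion matrices and the non-cyclic normal forms. -/

section CyclicVector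

variable {K : Type*} [Field K]

/-- The matrix with columns `v`, `A v`, `A² v`. -/
def krylov (A : Matrix (Fin 3) (Fin 3) K) (v : Fin 3 → K) : Matrix (Fin 3) (Fin 3) K :=
  (Matrix.of ![v, A *ᵥ v, A *ᵥ (A *ᵥ v)])ᵀ

/-- `A` has a cyclic vector. -/
def HasCyclicVector (A : Matrix (Fin 3) (Fin 3) K) : Prop := ∃ v, (krylov A v).det ≠ 0

/-- The equation A P = P B avoids inverses and also makes sense for matrices not yet known to be
invertible. -/
theorem isConj_iff_exists_matrix {A B : GL3 K} :
    IsConj A B ↔ ∃ P : Matrix (Fin 3) (Fin 3) K, P.det ≠ 0 ∧ A.1 * P = P * B.1 := by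
  rw [isConj_comm, isConj_iff]
  constructor
  · rintro ⟨c, hc⟩
    refine ⟨c.1, ((Matrix.isUnit_iff_isUnit_det _).1 c.isUnit).ne_zero, ?_⟩
    rw [← Units.val_mul, ← Units.val_mul, ← hc]
    simp
  · rintro ⟨P, hP, h⟩
    refine ⟨GeneralLinearGroup.mkOfDetNeZero P hP, ?_⟩
    rw [mul_inv_eq_iff_eq_mul]
    exact Units.ext h.symm

theorem charpoly_eq_of_mul_eq {A B P : Matrix (Fin 3) (Fin 3) K} (hP : P.det ≠ 0)
    (h : A * P = P * B) : A.charpoly = B.charpoly := by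
  have := Matrix.charpoly_units_conj (GeneralLinearGroup.mkOfDetNeZero P hP) B
  rw [← this]
  congr 1
  have h2 : (GeneralLinearGroup.mkOfDetNeZero P hP).1 * B = A * P := h.symm
  rw [h2]
  exact (mul_nonsing_inv_cancel_right P A (Ne.isUnit hP)).symm

theorem charpoly_eq_of_isConj {A B : GL3 K} (h : IsConj A B) : A.1.charpoly = B.1.charpoly := by
  obtain ⟨P, hP, h⟩ := isConj_iff_exists_matrix.1 h
  exact charpoly_eq_of_mul_eq hP h

/-- With P invertible this carries cyclic vectors across a similarity; with A = B it shows that a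
matrix commuting with A is determined by its value on a cyclic vector. -/
theorem krylov_mulVec {A B P : Matrix (Fin 3) (Fin 3) K} (h : A * P = P * B) (v : Fin 3 → K) :
    krylov A (P *ᵥ v) = P * krylov B v := by
  ext i j
  fin_cases j
  · rfl
  · change (A *ᵥ (P *ᵥ v)) i = (P *ᵥ (B *ᵥ v)) i
    rw [mulVec_mulVec, mulVec_mulVec, h]
  · change (A *ᵥ (A *ᵥ (P *ᵥ v))) i = (P *ᵥ (B *ᵥ (B *ᵥ v))) i
    simp only [mulVec_mulVec]
    rw [h, ← mul_assoc, h, mul_assoc]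

theorem HasCyclicVector.of_mul_eq {A B P : Matrix (Fin 3) (Fin 3) K} (hP : P.det ≠ 0)
    (h : A * P = P * B) (hB : HasCyclicVector B) : HasCyclicVector A := by
  obtain ⟨v, hv⟩ := hB
  refine ⟨P *ᵥ v, ?_⟩
  rw [krylov_mulVec h, det_mul]
  exact mul_ne_zero hP hv

theorem hasCyclicVector_iff_of_isConj {A B : GL3 K} (h : IsConj A B) :
    HasCyclicVector A.1 ↔ HasCyclicVector B.1 := by
  obtain ⟨P, hP, h1⟩ := isConj_iff_exists_matrix.1 h
  obtain ⟨Q, hQ, h2⟩ := isConj_iff_exists_matrix.1 h.symm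
  exact ⟨HasCyclicVector.of_mul_eq hQ h2, HasCyclicVector.of_mul_eq hP h1⟩

/-- The companion matrix of `X³ - c 2 X² - c 1 X - c 0`. -/
def companion3 (c : Fin 3 → K) : Matrix (Fin 3) (Fin 3) K :=
  !![0, 0, c 0; 1, 0, c 1; 0, 1, c 2]

open Polynomial in
theorem charpoly_companion3 (c : Fin 3 → K) :
    (companion3 c).charpoly = X ^ 3 - C (c 2) * X ^ 2 - C (c 1) * X - C (c 0) := by
  simp only [companion3, Matrix.charpoly, Matrix.det_fin_three, charmatrix_apply]
  simp
  ring

theorem charpoly_companion3_injective {c d : Fin 3 → K}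
    (h : (companion3 c).charpoly = (companion3 d).charpoly) : c = d := by
  rw [charpoly_companion3, charpoly_companion3] at h
  funext i
  have := congrArg (fun f => Polynomial.coeff f i) h
  fin_cases i <;> simpa [Polynomial.coeff_X, Polynomial.coeff_C, Polynomial.coeff_X_pow] using this

theorem exists_mul_krylov {A : Matrix (Fin 3) (Fin 3) K} {v : Fin 3 → K}
    (hv : (krylov A v).det ≠ 0) : ∃ c, A * krylov A v = krylov A v * companion3 c := by
  -- The last column of the companion matrix consists of the coordinates of A³v in the basis v, Av,
  -- A²v.
  refine ⟨(krylov A v)⁻¹ *ᵥ (A *ᵥ (A *ᵥ (A *ᵥ v))), ?_⟩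
  have h := mulVec_mulVec (A *ᵥ (A *ᵥ (A *ᵥ v))) (krylov A v) (krylov A v)⁻¹
  rw [mul_nonsing_inv _ (Ne.isUnit hv), one_mulVec] at h
  generalize (krylov A v)⁻¹ *ᵥ (A *ᵥ (A *ᵥ (A *ᵥ v))) = c at *
  ext i j
  fin_cases j
  · change (A *ᵥ v) i = _
    simp [Matrix.mul_apply, Fin.sum_univ_three, companion3, krylov]
  · change (A *ᵥ (A *ᵥ v)) i = _
    simp [Matrix.mul_apply, Fin.sum_univ_three, companion3, krylov]
  · change (A *ᵥ (A *ᵥ (A *ᵥ v))) i = _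
    rw [← h]
    simp [Matrix.mul_apply, Fin.sum_univ_three, companion3, mulVec, dotProduct]

/-- Each matrix is similar to a companion matrix, and a companion matrix can be recovered from its
characteristic polynomial. -/
theorem exists_matrix_of_charpoly_eq {A B : Matrix (Fin 3) (Fin 3) K} (hA : HasCyclicVector A)
    (hB : HasCyclicVector B) (h : A.charpoly = B.charpoly) :
    ∃ P : Matrix (Fin 3) (Fin 3) K, P.det ≠ 0 ∧ A * P = P * B := by
  obtain ⟨v, hv⟩ := hA
  obtain ⟨w, hw⟩ := hB
  obtain ⟨c, hc⟩ := exists_mul_krylov hv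
  obtain ⟨d, hd⟩ := exists_mul_krylov hw
  have hcd : c = d := charpoly_companion3_injective
    (by rw [← charpoly_eq_of_mul_eq hv hc, ← charpoly_eq_of_mul_eq hw hd, h])
  subst hcd
  have hu := Ne.isUnit hw
  refine ⟨krylov A v * (krylov B w)⁻¹, ?_, ?_⟩
  · rw [det_mul]
    exact mul_ne_zero hv ((isUnit_nonsing_inv_det _ hu).ne_zero)
  · have h1 : (krylov B w)⁻¹ * B = companion3 c * (krylov B w)⁻¹ := by
      rw [← nonsing_inv_mul_cancel_left (krylov B w) (companion3 c * (krylov B w)⁻¹) hu,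
        ← mul_assoc (krylov B w), ← hd, mul_nonsing_inv_cancel_right _ _ hu]
    rw [← mul_assoc, hc, mul_assoc, mul_assoc, h1]

theorem isConj_of_charpoly_eq {A B : GL3 K} (hA : HasCyclicVector A.1)
    (hB : HasCyclicVector B.1) (h : A.1.charpoly = B.1.charpoly) : IsConj A B :=
  isConj_iff_exists_matrix.2 (exists_matrix_of_charpoly_eq hA hB h)

theorem hasCyclicVector_companion3 (c : Fin 3 → K) : HasCyclicVector (companion3 c) := by
  refine ⟨![1, 0, 0], ?_⟩
  simp [krylov, companion3, det_fin_three, dotProduct, Fin.sum_univ_three]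

theorem HasCyclicVector.map {L : Type*} [Field L] (f : K →+* L) {A : Matrix (Fin 3) (Fin 3) K}
    (hA : HasCyclicVector A) : HasCyclicVector (A.map f) := by
  obtain ⟨v, hv⟩ := hA
  refine ⟨f ∘ v, ?_⟩
  have h (w : Fin 3 → K) : A.map f *ᵥ (f ∘ w) = f ∘ (A *ᵥ w) := by
    funext i
    exact (RingHom.map_mulVec f A w i).symm
  have h2 : krylov (A.map f) (f ∘ v) = (krylov A v).map f := by
    ext i j
    simp only [krylov, h]
    fin_cases j <;> rfl
  rw [h2, ← RingHom.mapMatrix_apply, ← RingHom.map_det]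
  exact (map_ne_zero f).2 hv

/-- An endomorphism for which every vector is an eigenvector is a homothety. -/
theorem exists_linearIndependent_pair {A : Matrix (Fin 3) (Fin 3) K}
    (h : ∀ a : K, A ≠ Matrix.scalar (Fin 3) a) :
    ∃ v, LinearIndependent K ![v, A *ᵥ v] := by
  by_contra! hn
  obtain ⟨a, ha⟩ := (Matrix.toLin' A).exists_eq_smul_id_of_forall_notLinearIndependent
    (fun v => by simpa using hn v)
  refine h a ?_
  apply Matrix.toLin'.injective
  rw [ha]
  ext i j
  simp [Pi.single_apply]

/-- A matrix without a cyclic vector is scalar, or similar to one of two standard matrices. -/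
theorem exists_standard_of_not_hasCyclicVector {A : Matrix (Fin 3) (Fin 3) K}
    (hA : ¬ HasCyclicVector A) :
    (∃ (a b : K) (P : Matrix (Fin 3) (Fin 3) K), P.det ≠ 0 ∧
      A * P = P * Matrix.diagonal ![a, a, b]) ∨
    (∃ (a : K) (P : Matrix (Fin 3) (Fin 3) K), P.det ≠ 0 ∧
      A * P = P * !![a, 1, 0; 0, a, 0; 0, 0, a]) := by
  by_cases hs : ∃ a : K, A = Matrix.scalar (Fin 3) a
  · obtain ⟨a, rfl⟩ := hs
    refine Or.inl ⟨a, a, 1, by simp, ?_⟩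
    ext i j
    fin_cases i <;> fin_cases j <;> simp
  push Not at hs
  obtain ⟨v, hv⟩ := exists_linearIndependent_pair hs
  have hlt : Submodule.span K (Set.range ![v, A *ᵥ v]) < ⊤ := by
    apply Submodule.lt_top_of_finrank_lt_finrank
    rw [finrank_span_eq_card hv]
    simp
  obtain ⟨u, -, hu⟩ := SetLike.exists_of_lt hlt
  have hli : LinearIndependent K ![v, A *ᵥ v, u] := by
    have := (linearIndependent_finSnoc (v := ![v, A *ᵥ v]) (x := u)).2 ⟨hv, hu⟩
    have h3 : (Fin.snoc ![v, A *ᵥ v] u : Fin 3 → Fin 3 → K) = ![v, A *ᵥ v, u] := by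
      funext i
      fin_cases i <;> rfl
    rwa [h3] at this
  set P : Matrix (Fin 3) (Fin 3) K := (Matrix.of ![v, A *ᵥ v, u])ᵀ with hPdef
  have hP : P.det ≠ 0 := by
    rw [hPdef, det_transpose]
    exact ((Matrix.isUnit_iff_isUnit_det _).1
      (Matrix.linearIndependent_rows_iff_isUnit.1 hli)).ne_zero
  obtain ⟨c₀, c₁, d, x, y, r, hM⟩ : ∃ c₀ c₁ d x y r : K,
      A * P = P * !![0, c₀, x; 1, c₁, y; 0, d, r] := by
    have h := mul_nonsing_inv_cancel_left P (A * P) (Ne.isUnit hP)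
    generalize P⁻¹ * (A * P) = N at h
    -- In the basis v, Av, u the first column is (0, 1, 0), since A sends the first basis vector to
    -- the second.
    refine ⟨N 0 1, N 1 1, N 2 1, N 0 2, N 1 2, N 2 2, ?_⟩
    ext i j
    fin_cases j
    · change (A *ᵥ v) i = _
      simp [Matrix.mul_apply, Fin.sum_univ_three, hPdef]
    · rw [← h]
      simp [Matrix.mul_apply, Fin.sum_univ_three]
    · rw [← h]
      simp [Matrix.mul_apply, Fin.sum_univ_three]
  have hN : ∀ w, (krylov !![0, c₀, x; 1, c₁, y; 0, d, r] w).det = 0 := by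
    intro w
    by_contra hw
    exact hA (HasCyclicVector.of_mul_eq hP hM ⟨w, hw⟩)
  have hd : d = 0 := by
    have := hN ![1, 0, 0]
    simpa [krylov, det_fin_three, mulVec, dotProduct, Fin.sum_univ_three] using this
  subst hd
  -- The first coordinate is chosen so that (N - r)w is a multiple t·e₁, where t is the left-hand
  -- side. The Krylov determinant of w is then t², and it vanishes because w is not cyclic.
  have hk (β : K) : x + r * y - β * (r ^ 2 - c₁ * r - c₀) = 0 := by
    have := hN ![-y - (c₁ - r) * β, β, 1]
    simp [krylov, det_fin_three, dotProduct, Fin.sum_univ_three] at this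
    refine pow_eq_zero_iff (n := 2) two_ne_zero |>.1 ?_
    linear_combination this
  have hx := hk 0
  have hf := hk 1
  obtain rfl : x = -(r * y) := by linear_combination hx
  obtain rfl : c₀ = r ^ 2 - c₁ * r := by linear_combination hf
  -- Now r is a root of X² - c₁X - c₀, the characteristic polynomial of the block on v, Av; s is the
  -- other root.
  obtain ⟨s, rfl⟩ : ∃ s, c₁ = r + s := ⟨c₁ - r, by ring⟩
  by_cases hrs : s = r
  · subst hrs
    -- The new basis is (A - s)v, v, u - yv: a Jordan chain of length two and a further eigenvector.
    refine Or.inr ⟨s, P * !![-s, 1, -y; 1, 0, 0; 0, 0, 1], ?_, ?_⟩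
    · rw [det_mul]
      refine mul_ne_zero hP ?_
      simp [det_fin_three]
    · rw [← mul_assoc, hM, mul_assoc, mul_assoc]
      congr 1
      ext i j
      fin_cases i <;> fin_cases j <;> simp [Matrix.mul_apply, Fin.sum_univ_three] <;> ring
  -- The new basis is (A - s)v, u - yv, (A - r)v: eigenvectors for r, r and s.
  · refine Or.inl ⟨r, s, P * !![-s, -y, -r; 1, 0, 1; 0, 1, 0], ?_, ?_⟩
    · rw [det_mul]
      refine mul_ne_zero hP ?_
      have : s - r ≠ 0 := sub_ne_zero.2 hrs
      simp [det_fin_three]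
      intro h
      apply this
      linear_combination h
    · rw [← mul_assoc, hM, mul_assoc, mul_assoc]
      congr 1
      ext i j
      fin_cases i <;> fin_cases j <;>
        simp [Matrix.mul_apply, Fin.sum_univ_three, diagonal_apply] <;> ring

end CyclicVector

end

section

/-! ### Standard forms and descent of conjugacy along a field extension. -/

section StandardForms

variable {K L : Type*} [Field K] [Field L]

open Polynomial in
/-- The polynomial `(X - x) (X - y) (X - z)`. -/
def cubic (x y z : K) : K[X] := (X - C x) * (X - C y) * (X - C z)

open Polynomial in
theorem cubic_eq (x y z : K) :
    cubic x y z = ((({x, y, z} : Multiset K).map fun a => X - C a).prod) := by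
  simp [cubic, mul_assoc]

theorem roots_cubic (x y z : K) : (cubic x y z).roots = {x, y, z} := by
  rw [cubic_eq, Polynomial.roots_multiset_prod_X_sub_C]

theorem eval_cubic (x y z t : K) : (cubic x y z).eval t = (t - x) * (t - y) * (t - z) := by
  simp [cubic]

theorem cubic_rotate (x y z : K) : cubic x y z = cubic y z x := by
  simp only [cubic]
  ring

theorem cubic_swap (x y z : K) : cubic x y z = cubic y x z := by
  simp only [cubic]
  ring

theorem map_cubic (f : K →+* L) (x y z : K) :
    (cubic x y z).map f = cubic (f x) (f y) (f z) := by
  simp [cubic]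

theorem eq_or_eq_or_eq_of_cubic_eq {x y z x' y' z' : K} (h : cubic x y z = cubic x' y' z') :
    x = x' ∨ x = y' ∨ x = z' := by
  have h1 := congrArg (Polynomial.eval x) h
  simpa [eval_cubic, sub_eq_zero, or_assoc] using h1.symm

/-- Among three roots counted with multiplicity only one value can occur twice, so the repeated
root, and with it the remaining one, is determined. -/
theorem eq_and_eq_of_cubic_eq {a b a' b' : K} (h : cubic a a b = cubic a' a' b') :
    a = a' ∧ b = b' := by
  classical
  have h1 := congrArg Polynomial.roots h
  rw [roots_cubic, roots_cubic] at h1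
  have h2 (t : K) := congrArg (Multiset.count t) h1
  simp only [Multiset.insert_eq_cons, Multiset.count_cons, Multiset.count_singleton] at h2
  have h3 := h2 a
  have h4 := h2 b
  have h5 := h2 b'
  have h6 := h2 a'
  by_cases h7 : a = a'
  · subst h7
    refine ⟨rfl, ?_⟩
    by_contra h8
    simp_all
  · exfalso
    simp only [if_true, h7, Ne.symm h7, if_false] at h3 h6
    split_ifs at h3 h6 <;> omega

theorem charpoly_diag3 (a b c : Kˣ) : (diag3 ![a, b, c]).1.charpoly = cubic (a : K) b c := by
  change (Matrix.diagonal _).charpoly = _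
  rw [charpoly_diagonal, Fin.prod_univ_three]
  rfl

theorem charpoly_jordan21 (a b : Kˣ) : (jordan21 a b).1.charpoly = cubic (a : K) a b := by
  change (!![(a : K), 1, 0; 0, a, 0; 0, 0, b] : Matrix (Fin 3) (Fin 3) K).charpoly = _
  simp only [Matrix.charpoly, Matrix.det_fin_three, charmatrix_apply]
  simp [cubic]

theorem charpoly_jordan3 (a : Kˣ) : (jordan3 a).1.charpoly = cubic (a : K) a a := by
  change (!![(a : K), 1, 0; 0, a, 1; 0, 0, a] : Matrix (Fin 3) (Fin 3) K).charpoly = _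
  simp only [Matrix.charpoly, Matrix.det_fin_three, charmatrix_apply]
  simp [cubic]

theorem hasCyclicVector_diagonal {a b c : K} (hab : a ≠ b) (hac : a ≠ c) (hbc : b ≠ c) :
    HasCyclicVector (Matrix.diagonal ![a, b, c]) := by
  refine ⟨![1, 1, 1], ?_⟩
  -- The Krylov matrix of (1, 1, 1) is the Vandermonde matrix of a, b, c.
  have h : (krylov (Matrix.diagonal ![a, b, c]) ![1, 1, 1]).det = (b - a) * (c - a) * (c - b) := by
    simp [krylov, det_fin_three, mulVec_diagonal]
    ring
  rw [h]
  simp [sub_eq_zero, hab.symm, hac.symm, hbc.symm]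

theorem hasCyclicVector_diag3 {a b c : Kˣ} (hab : a ≠ b) (hac : a ≠ c) (hbc : b ≠ c) :
    HasCyclicVector (diag3 ![a, b, c]).1 := by
  have := hasCyclicVector_diagonal (a := (a : K)) (b := b) (c := c) (fun h => hab (Units.ext h))
    (fun h => hac (Units.ext h)) (fun h => hbc (Units.ext h))
  convert this using 1
  ext i j
  fin_cases i <;> fin_cases j <;> rfl

theorem hasCyclicVector_jordan21 {a b : Kˣ} (hab : a ≠ b) : HasCyclicVector (jordan21 a b).1 := by
  have hab' : (b : K) - a ≠ 0 := sub_ne_zero.2 fun h => hab (Units.ext h).symm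
  change HasCyclicVector (!![(a : K), 1, 0; 0, a, 0; 0, 0, b] : Matrix (Fin 3) (Fin 3) K)
  refine ⟨![0, 1, 1], ?_⟩
  have h : (krylov (!![(a : K), 1, 0; 0, a, 0; 0, 0, b] : Matrix (Fin 3) (Fin 3) K)
      ![0, 1, 1]).det = -((b : K) - a) ^ 2 := by
    simp [krylov, det_fin_three, Matrix.vecHead, Matrix.vecTail]
    ring
  rw [h]
  simpa using hab'

theorem hasCyclicVector_jordan3 (a : Kˣ) : HasCyclicVector (jordan3 a).1 := by
  change HasCyclicVector (!![(a : K), 1, 0; 0, a, 1; 0, 0, a] : Matrix (Fin 3) (Fin 3) K)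
  refine ⟨![0, 0, 1], ?_⟩
  have h : (krylov (!![(a : K), 1, 0; 0, a, 1; 0, 0, a] : Matrix (Fin 3) (Fin 3) K)
      ![0, 0, 1]).det = -1 := by
    simp [krylov, det_fin_three, Matrix.vecHead, Matrix.vecTail]
  rw [h]
  simp

/-- The matrix is annihilated by (X - a)(X - b), of degree two, so v, Av, A²v are always dependent.
-/
theorem not_hasCyclicVector_diag3 (a b : Kˣ) : ¬ HasCyclicVector (diag3 ![a, a, b]).1 := by
  rintro ⟨v, hv⟩
  apply hv
  change (krylov (Matrix.diagonal _) v).det = 0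
  simp [krylov, det_fin_three, mulVec_diagonal]
  ring

theorem not_hasCyclicVector_jordan21 (a : Kˣ) : ¬ HasCyclicVector (jordan21 a a).1 := by
  rintro ⟨v, hv⟩
  apply hv
  change (krylov (!![(a : K), 1, 0; 0, a, 0; 0, 0, a] : Matrix (Fin 3) (Fin 3) K) v).det = 0
  simp [krylov, det_fin_three]
  simp [Matrix.vecHead, Matrix.vecTail]
  ring

theorem isConj_standard_of_not_hasCyclicVector {γ : GL3 K} (h : ¬ HasCyclicVector γ.1) :
    (∃ a b : Kˣ, IsConj (diag3 ![a, a, b]) γ) ∨ ∃ a : Kˣ, IsConj (jordan21 a a) γ := by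
  have hdet : γ.1.det ≠ 0 := ((Matrix.isUnit_iff_isUnit_det _).1 γ.isUnit).ne_zero
  have hB {P B : Matrix (Fin 3) (Fin 3) K} (hP : P.det ≠ 0) (h : γ.1 * P = P * B) :
      B.det ≠ 0 := by
    have h2 := congrArg det h
    rw [det_mul, det_mul, mul_comm] at h2
    rw [← mul_left_cancel₀ hP h2]
    exact hdet
  rcases exists_standard_of_not_hasCyclicVector h with ⟨a, b, P, hP, hc⟩ | ⟨a, P, hP, hc⟩
  · have h3 := hB hP hc
    simp [det_diagonal, Fin.prod_univ_three] at h3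
    refine Or.inl ⟨Units.mk0 a h3.1, Units.mk0 b h3.2,
      (isConj_iff_exists_matrix.2 ⟨P, hP, ?_⟩).symm⟩
    rw [hc]
    congr 1
    ext i j
    fin_cases i <;> fin_cases j <;> rfl
  · have h3 := hB hP hc
    simp [det_fin_three] at h3
    exact Or.inr ⟨Units.mk0 a h3, (isConj_iff_exists_matrix.2 ⟨P, hP, hc⟩).symm⟩

/-- Both non-cyclic standard forms have a repeated eigenvalue, which stays repeated in L. -/
theorem hasCyclicVector_of_charpoly_map {γ : GL3 K} {f : K →+* L} {x y z : L}
    (h : γ.1.charpoly.map f = cubic x y z) (hxy : x ≠ y) (hxz : x ≠ z) (hyz : y ≠ z) :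
    HasCyclicVector γ.1 := by
  by_contra hn
  have key (a b : Kˣ) (hc : γ.1.charpoly = cubic (a : K) a b) : False := by
    rw [hc, map_cubic] at h
    have h1 := congrArg Polynomial.roots h
    rw [roots_cubic, roots_cubic] at h1
    have h2 : ({x, y, z} : Multiset L).Nodup := by simp [hxy, hxz, hyz]
    rw [← h1] at h2
    simp at h2
  rcases isConj_standard_of_not_hasCyclicVector hn with ⟨a, b, hc⟩ | ⟨a, hc⟩
  · exact key a b (by rw [← charpoly_eq_of_isConj hc, charpoly_diag3])
  · exact key a a (by rw [← charpoly_eq_of_isConj hc, charpoly_jordan21])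

theorem charpoly_mapGL (f : K →+* L) (A : GL3 K) :
    (GeneralLinearGroup.map f A).1.charpoly = A.1.charpoly.map f :=
  Matrix.charpoly_map A.1 f

theorem hasCyclicVector_mapGL {f : K →+* L} {A : GL3 K} (h : HasCyclicVector A.1) :
    HasCyclicVector (GeneralLinearGroup.map f A).1 :=
  h.map f

theorem mapGL_diag3 (f : K →+* L) (a b c : Kˣ) :
    GeneralLinearGroup.map f (diag3 ![a, b, c]) =
      diag3 ![Units.map f a, Units.map f b, Units.map f c] := by
  ext i j
  change f (Matrix.diagonal _ i j) = Matrix.diagonal _ i j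
  fin_cases i <;> fin_cases j <;> simp

theorem mapGL_jordan21 (f : K →+* L) (a b : Kˣ) :
    GeneralLinearGroup.map f (jordan21 a b) = jordan21 (Units.map f a) (Units.map f b) := by
  ext i j
  change f ((!![(a : K), 1, 0; 0, a, 0; 0, 0, b] : Matrix (Fin 3) (Fin 3) K) i j) =
    (!![f (a : K), 1, 0; 0, f a, 0; 0, 0, f b] : Matrix (Fin 3) (Fin 3) L) i j
  fin_cases i <;> fin_cases j <;> simp

theorem mapGL_jordan3 (f : K →+* L) (a : Kˣ) :
    GeneralLinearGroup.map f (jordan3 a) = jordan3 (Units.map f a) := by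
  ext i j
  change f ((!![(a : K), 1, 0; 0, a, 1; 0, 0, a] : Matrix (Fin 3) (Fin 3) K) i j) =
    (!![f (a : K), 1, 0; 0, f a, 1; 0, 0, f a] : Matrix (Fin 3) (Fin 3) L) i j
  fin_cases i <;> fin_cases j <;> simp

theorem diag3_eq_scalar (a : Kˣ) : (diag3 ![a, a, a]).1 = Matrix.scalar (Fin 3) (a : K) := by
  change Matrix.diagonal _ = _
  ext i j
  fin_cases i <;> fin_cases j <;> simp

theorem eq_of_isConj_diag3_scalar {a : Kˣ} {γ : GL3 K} (h : IsConj (diag3 ![a, a, a]) γ) :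
    γ = diag3 ![a, a, a] := by
  obtain ⟨c, hc⟩ := isConj_iff.1 h
  have h2 : c * diag3 ![a, a, a] = diag3 ![a, a, a] * c := by
    refine Units.ext ?_
    rw [Units.val_mul, Units.val_mul, diag3_eq_scalar]
    exact (scalar_commute (a : K) (fun r => Commute.all _ _) c.1).symm
  rw [← hc, h2, mul_inv_cancel_right]

/-- Equal characteristic polynomials would make the diagonal matrix scalar, and a scalar matrix is
conjugate only to itself. -/
theorem not_isConj_diag3_jordan21 (a b c : Kˣ) : ¬ IsConj (diag3 ![a, a, b]) (jordan21 c c) := by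
  intro h
  have h1 := charpoly_eq_of_isConj h
  rw [charpoly_diag3, charpoly_jordan21] at h1
  obtain ⟨h2, h3⟩ := eq_and_eq_of_cubic_eq h1
  obtain rfl : a = c := Units.ext h2
  obtain rfl : b = a := Units.ext h3
  have h4 := congrArg (fun M : GL3 K => M.1 0 1) (eq_of_isConj_diag3_scalar h)
  simp [diag3, jordan21, GeneralLinearGroup.mkOfDetNeZero] at h4

/-- Matrices over a field that are conjugate over an extension field are conjugate. -/
theorem isConj_of_isConj_mapGL (f : K →+* L) {A B : GL3 K}
    (h : IsConj (GeneralLinearGroup.map f A) (GeneralLinearGroup.map f B)) : IsConj A B := by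
  have hcp : A.1.charpoly = B.1.charpoly := by
    have := charpoly_eq_of_isConj h
    rw [charpoly_mapGL, charpoly_mapGL] at this
    exact Polynomial.map_injective f f.injective this
  -- Extending the field creates no cyclic vector: the non-cyclic standard forms keep their shape
  -- over L.
  have key {C : GL3 K} (hC : ¬ HasCyclicVector C.1) :
      ¬ HasCyclicVector (GeneralLinearGroup.map f C).1 := by
    rcases isConj_standard_of_not_hasCyclicVector hC with ⟨a, b, hc⟩ | ⟨a, hc⟩
    · rw [← hasCyclicVector_iff_of_isConj ((GeneralLinearGroup.map f).map_isConj hc), mapGL_diag3]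
      exact not_hasCyclicVector_diag3 _ _
    · rw [← hasCyclicVector_iff_of_isConj ((GeneralLinearGroup.map f).map_isConj hc),
        mapGL_jordan21]
      exact not_hasCyclicVector_jordan21 _
  have hcyc : HasCyclicVector A.1 ↔ HasCyclicVector B.1 := by
    constructor <;> intro h1 <;> by_contra h2
    · exact key h2 ((hasCyclicVector_iff_of_isConj h).1 (hasCyclicVector_mapGL h1))
    · exact key h2 ((hasCyclicVector_iff_of_isConj h).2 (hasCyclicVector_mapGL h1))
  by_cases hA : HasCyclicVector A.1
  · exact isConj_of_charpoly_eq hA (hcyc.1 hA) hcp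
  have hB := fun h1 => hA (hcyc.2 h1)
  -- The two kinds of non-cyclic form remain non-conjugate over L; within one kind the
  -- characteristic polynomial determines the parameters.
  have key2 {C D : GL3 K} {a b c : Kˣ} (hC : IsConj (diag3 ![a, a, b]) C)
      (hD : IsConj (jordan21 c c) D)
      (h : IsConj (GeneralLinearGroup.map f C) (GeneralLinearGroup.map f D)) : False := by
    have h1 := (((GeneralLinearGroup.map f).map_isConj hC).trans h).trans
      ((GeneralLinearGroup.map f).map_isConj hD).symm
    rw [mapGL_diag3, mapGL_jordan21] at h1
    exact not_isConj_diag3_jordan21 _ _ _ h1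
  rcases isConj_standard_of_not_hasCyclicVector hA with ⟨a, b, hc⟩ | ⟨a, hc⟩ <;>
  rcases isConj_standard_of_not_hasCyclicVector hB with ⟨a', b', hc'⟩ | ⟨a', hc'⟩
  · rw [← charpoly_eq_of_isConj hc, ← charpoly_eq_of_isConj hc', charpoly_diag3,
      charpoly_diag3] at hcp
    obtain ⟨h2, h3⟩ := eq_and_eq_of_cubic_eq hcp
    obtain rfl := Units.ext h2
    obtain rfl := Units.ext h3
    exact hc.symm.trans hc'
  · exact (key2 hc hc' h).elim
  · exact (key2 hc' hc h.symm).elim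
  · rw [← charpoly_eq_of_isConj hc, ← charpoly_eq_of_isConj hc', charpoly_jordan21,
      charpoly_jordan21] at hcp
    obtain rfl := Units.ext (eq_and_eq_of_cubic_eq hcp).1
    exact hc.symm.trans hc'

end StandardForms

end

section

/-! ### Sizes of the classes with all eigenvalues in the base field. -/

section ClassSizes

variable {K : Type*} [Field K]

theorem natCard_GL [Finite K] (n : ℕ) :
    Nat.card (GL (Fin n) K) = ∏ i : Fin n, (Nat.card K ^ n - Nat.card K ^ (i : ℕ)) := by
  have := Fintype.ofFinite K
  rw [Matrix.card_GL_field, Nat.card_eq_fintype_card]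

theorem natCard_units_field [Finite K] : Nat.card Kˣ = Nat.card K - 1 :=
  Nat.card_units K

/-- The orders of the groups that occur, as polynomials in `Q - 1`. -/
theorem sub_one_formulas (k : ℕ) :
    (k + 1 - 1 = k) ∧ ((k + 1) ^ 2 - 1 = k * (k + 2)) ∧
    ((k + 1) ^ 3 - 1 = k * (k ^ 2 + 3 * k + 3)) ∧
    ((k + 1) ^ 2 - (k + 1) = (k + 1) * k) ∧
    ((k + 1) ^ 3 - (k + 1) = (k + 1) * (k * (k + 2))) ∧
    ((k + 1) ^ 3 - (k + 1) ^ 2 = (k + 1) ^ 2 * k) := by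
  refine ⟨rfl, ?_, ?_, ?_, ?_, ?_⟩ <;> refine Nat.sub_eq_of_eq_add ?_ <;> ring

/-- Reduces a class size to a parametrization of the invertible matrices commuting with γ. Stating
the count as a product avoids division in ℕ. -/
theorem classSize_eq_of_param [Finite K] (γ : GL3 K) {T : Type*}
    (f : T → Matrix (Fin 3) (Fin 3) K) (hf : Function.Injective f)
    (h : ∀ M : Matrix (Fin 3) (Fin 3) K,
      M ∈ Set.range f ↔ M * γ.1 = γ.1 * M ∧ M.det ≠ 0)
    {s : ℕ} (hs : s * Nat.card T = Nat.card (GL3 K)) : classSize γ = s := by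
  have h1 : Nat.card (Subgroup.centralizer {γ}) = Nat.card T := by
    rw [← Nat.card_range_of_injective hf]
    refine Nat.card_congr (Equiv.ofBijective
      (fun g => ⟨g.1.1, (h _).2 ⟨?_, ?_⟩⟩) ⟨?_, ?_⟩)
    · exact congrArg Units.val (Subgroup.mem_centralizer_singleton_iff.1 g.2)
    · exact ((Matrix.isUnit_iff_isUnit_det _).1 g.1.isUnit).ne_zero
    · intro g g' hg
      exact Subtype.ext (Units.ext (congrArg Subtype.val hg))
    · rintro ⟨M, hM⟩
      obtain ⟨h2, h3⟩ := (h M).1 hM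
      exact ⟨⟨GeneralLinearGroup.mkOfDetNeZero M h3,
        Subgroup.mem_centralizer_singleton_iff.2 (Units.ext h2)⟩, rfl⟩
  have h2 := classSize_mul_card_centralizer γ
  rw [h1, ← hs] at h2
  have h3 : 0 < Nat.card T := by
    rw [← h1]
    exact Nat.card_pos
  exact Nat.eq_of_mul_eq_mul_right h3 h2

theorem exists_natCard_eq_add_one [Finite K] : ∃ k, Nat.card K = k + 1 :=
  ⟨Nat.card K - 1, (Nat.sub_add_cancel Nat.card_pos).symm⟩

theorem classSize_diag3_scalar (a : Kˣ) : classSize (diag3 ![a, a, a]) = 1 := by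
  have : conjugatesOf (diag3 ![a, a, a]) = {diag3 ![a, a, a]} := by
    ext x
    exact ⟨fun h => eq_of_isConj_diag3_scalar h, fun h => by rw [h]; exact mem_conjugatesOf_self⟩
  rw [classSize, this]
  simp

theorem diag3_val (a b c : Kˣ) :
    (diag3 ![a, b, c]).1 = !![(a : K), 0, 0; 0, b, 0; 0, 0, c] := by
  ext i j
  fin_cases i <;> fin_cases j <;> rfl

/-- A commuting matrix preserves the two eigenspaces, so the centralizer is GL₂(K) × Kˣ. -/
theorem classSize_diag3_of_ne [Finite K] {a b : Kˣ} (hab : a ≠ b) :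
    classSize (diag3 ![a, a, b]) = sizeH1 (Nat.card K) := by
  have hab' : (a : K) - b ≠ 0 := sub_ne_zero.2 fun h => hab (Units.ext h)
  refine classSize_eq_of_param _
    (fun t : GL (Fin 2) K × Kˣ =>
      !![t.1.1 0 0, t.1.1 0 1, 0; t.1.1 1 0, t.1.1 1 1, 0; 0, 0, (t.2 : K)]) ?_ ?_ ?_
  · rintro ⟨g, t⟩ ⟨g', t'⟩ h
    have h1 (i j : Fin 3) := congrFun (congrFun h i) j
    refine Prod.ext (Units.ext ?_) (Units.ext (h1 2 2))
    ext i j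
    fin_cases i <;> fin_cases j
    · exact h1 0 0
    · exact h1 0 1
    · exact h1 1 0
    · exact h1 1 1
  · intro M
    rw [diag3_val]
    constructor
    · rintro ⟨⟨g, t⟩, rfl⟩
      refine ⟨?_, ?_⟩
      · ext i j
        fin_cases i <;> fin_cases j <;> simp [Matrix.mul_apply, Fin.sum_univ_three] <;> ring
      · have hg : g.1.det ≠ 0 := ((Matrix.isUnit_iff_isUnit_det _).1 g.isUnit).ne_zero
        rw [det_fin_two] at hg
        have h2 := mul_ne_zero hg t.ne_zero
        simp [det_fin_three]
        intro h
        apply h2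
        linear_combination h
    · rintro ⟨hc, hd⟩
      have h1 (i j : Fin 3) := congrFun (congrFun hc i) j
      simp only [Matrix.mul_apply, Fin.sum_univ_three] at h1
      have h02 := h1 0 2
      have h12 := h1 1 2
      have h20 := h1 2 0
      have h21 := h1 2 1
      simp at h02 h12 h20 h21
      replace h02 : M 0 2 = 0 := mul_right_cancel₀ hab' (by linear_combination -h02)
      replace h12 : M 1 2 = 0 := mul_right_cancel₀ hab' (by linear_combination -h12)
      replace h20 : M 2 0 = 0 := mul_right_cancel₀ hab' (by linear_combination h20)
      replace h21 : M 2 1 = 0 := mul_right_cancel₀ hab' (by linear_combination h21)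
      rw [det_fin_three, h02, h12, h20, h21] at hd
      have hd2 : (M 0 0 * M 1 1 - M 0 1 * M 1 0) * M 2 2 ≠ 0 := by
        intro h
        apply hd
        linear_combination h
      refine ⟨⟨GeneralLinearGroup.mkOfDetNeZero !![M 0 0, M 0 1; M 1 0, M 1 1]
        (by rw [det_fin_two]; exact left_ne_zero_of_mul hd2),
        Units.mk0 (M 2 2) (right_ne_zero_of_mul hd2)⟩, ?_⟩
      ext i j
      fin_cases i <;> fin_cases j <;>
        simp [GeneralLinearGroup.mkOfDetNeZero, h02, h12, h20, h21]
  -- Writing the cardinality as k + 1 turns the truncated subtractions in the group orders into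
  -- polynomials in k, which `ring` can compare.
  · obtain ⟨k, hk⟩ := exists_natCard_eq_add_one (K := K)
    obtain ⟨h1, h2, h3, h4, h5, h6⟩ := sub_one_formulas k
    rw [Nat.card_prod, natCard_GL, natCard_GL, natCard_units_field, hk, Fin.prod_univ_three,
      Fin.prod_univ_two, sizeH1]
    simp only [Fin.val_zero, Fin.val_one, Fin.val_two, pow_zero, pow_one, h1, h2, h3, h4, h5, h6]
    ring

theorem classSize_diag3_of_ne_of_ne [Finite K] {a b c : Kˣ} (hab : a ≠ b) (hac : a ≠ c)
    (hbc : b ≠ c) : classSize (diag3 ![a, b, c]) = sizeH2 (Nat.card K) := by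
  have hab' : (a : K) - b ≠ 0 := sub_ne_zero.2 fun h => hab (Units.ext h)
  have hac' : (a : K) - c ≠ 0 := sub_ne_zero.2 fun h => hac (Units.ext h)
  have hbc' : (b : K) - c ≠ 0 := sub_ne_zero.2 fun h => hbc (Units.ext h)
  refine classSize_eq_of_param _
    (fun t : Kˣ × Kˣ × Kˣ => !![(t.1 : K), 0, 0; 0, t.2.1, 0; 0, 0, t.2.2]) ?_ ?_ ?_
  · rintro ⟨x, y, z⟩ ⟨x', y', z'⟩ h
    have h1 (i j : Fin 3) := congrFun (congrFun h i) j
    exact Prod.ext (Units.ext (h1 0 0)) (Prod.ext (Units.ext (h1 1 1)) (Units.ext (h1 2 2)))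
  · intro M
    rw [diag3_val]
    constructor
    · rintro ⟨⟨x, y, z⟩, rfl⟩
      refine ⟨?_, ?_⟩
      · ext i j
        fin_cases i <;> fin_cases j <;> simp [Matrix.mul_apply, Fin.sum_univ_three] <;> ring
      · simp [det_fin_three]
    · rintro ⟨hc, hd⟩
      have h1 (i j : Fin 3) := congrFun (congrFun hc i) j
      simp only [Matrix.mul_apply, Fin.sum_univ_three] at h1
      have h01 := h1 0 1
      have h02 := h1 0 2
      have h10 := h1 1 0
      have h12 := h1 1 2
      have h20 := h1 2 0
      have h21 := h1 2 1
      simp at h01 h02 h10 h12 h20 h21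
      replace h01 : M 0 1 = 0 := mul_right_cancel₀ hab' (by linear_combination -h01)
      replace h02 : M 0 2 = 0 := mul_right_cancel₀ hac' (by linear_combination -h02)
      replace h10 : M 1 0 = 0 := mul_right_cancel₀ hab' (by linear_combination h10)
      replace h12 : M 1 2 = 0 := mul_right_cancel₀ hbc' (by linear_combination -h12)
      replace h20 : M 2 0 = 0 := mul_right_cancel₀ hac' (by linear_combination h20)
      replace h21 : M 2 1 = 0 := mul_right_cancel₀ hbc' (by linear_combination h21)
      rw [det_fin_three, h01, h02, h10, h12, h20, h21] at hd
      have hd2 : M 0 0 * (M 1 1 * M 2 2) ≠ 0 := by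
        intro h
        apply hd
        linear_combination h
      refine ⟨⟨Units.mk0 (M 0 0) (left_ne_zero_of_mul hd2),
        Units.mk0 (M 1 1) (left_ne_zero_of_mul (right_ne_zero_of_mul hd2)),
        Units.mk0 (M 2 2) (right_ne_zero_of_mul (right_ne_zero_of_mul hd2))⟩, ?_⟩
      ext i j
      fin_cases i <;> fin_cases j <;> simp [h01, h02, h10, h12, h20, h21]
  · obtain ⟨k, hk⟩ := exists_natCard_eq_add_one (K := K)
    obtain ⟨h1, h2, h3, h4, h5, h6⟩ := sub_one_formulas k
    rw [Nat.card_prod, Nat.card_prod, natCard_GL, natCard_units_field, hk, Fin.prod_univ_three,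
      sizeH2]
    simp only [Fin.val_zero, Fin.val_one, Fin.val_two, pow_zero, pow_one, h1, h3, h5, h6]
    ring

theorem classSize_jordan21_self [Finite K] (a : Kˣ) :
    classSize (jordan21 a a) = sizeP1 (Nat.card K) := by
  refine classSize_eq_of_param _
    (fun t : Kˣ × Kˣ × K × K × K =>
      !![(t.1 : K), t.2.2.1, t.2.2.2.1; 0, t.1, 0; 0, t.2.2.2.2, t.2.1]) ?_ ?_ ?_
  · rintro ⟨x, y, z, u, v⟩ ⟨x', y', z', u', v'⟩ h
    have h1 (i j : Fin 3) := congrFun (congrFun h i) j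
    exact Prod.ext (Units.ext (h1 0 0)) (Prod.ext (Units.ext (h1 2 2)) (Prod.ext (h1 0 1)
      (Prod.ext (h1 0 2) (h1 2 1))))
  · intro M
    change _ ↔ M * !![(a : K), 1, 0; 0, a, 0; 0, 0, a] = !![(a : K), 1, 0; 0, a, 0; 0, 0, a] * M ∧ _
    constructor
    · rintro ⟨⟨x, y, z, u, v⟩, rfl⟩
      refine ⟨?_, ?_⟩
      · ext i j
        fin_cases i <;> fin_cases j <;> simp [Matrix.mul_apply, Fin.sum_univ_three] <;> ring
      · simp [det_fin_three]
    · rintro ⟨hc, hd⟩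
      have h1 (i j : Fin 3) := congrFun (congrFun hc i) j
      simp only [Matrix.mul_apply, Fin.sum_univ_three] at h1
      have h00 := h1 0 0
      have h01 := h1 0 1
      have h02 := h1 0 2
      have h21 := h1 2 1
      simp at h00 h01 h02 h21
      replace h10 : M 1 0 = 0 := by linear_combination -h00
      replace h11 : M 1 1 = M 0 0 := by linear_combination -h01
      replace h12 : M 1 2 = 0 := by linear_combination -h02
      replace h20 : M 2 0 = 0 := by linear_combination h21
      rw [det_fin_three, h10, h11, h12, h20] at hd
      have hd2 : M 0 0 * M 2 2 ≠ 0 := by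
        intro h
        apply hd
        linear_combination M 0 0 * h
      refine ⟨⟨Units.mk0 (M 0 0) (left_ne_zero_of_mul hd2),
        Units.mk0 (M 2 2) (right_ne_zero_of_mul hd2), M 0 1, M 0 2, M 2 1⟩, ?_⟩
      ext i j
      fin_cases i <;> fin_cases j <;> simp [h10, h11, h12, h20]
  · obtain ⟨k, hk⟩ := exists_natCard_eq_add_one (K := K)
    obtain ⟨h1, h2, h3, h4, h5, h6⟩ := sub_one_formulas k
    simp only [Nat.card_prod]
    rw [natCard_GL, natCard_units_field, hk, Fin.prod_univ_three, sizeP1]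
    simp only [Fin.val_zero, Fin.val_one, Fin.val_two, pow_zero, pow_one, h1, h3, h5, h6]
    ring

/-- The centralizer of a single Jordan block consists of the invertible polynomials in it, given by
their first row. -/
theorem classSize_jordan3 [Finite K] (a : Kˣ) :
    classSize (jordan3 a) = sizeP2 (Nat.card K) := by
  refine classSize_eq_of_param _
    (fun t : Kˣ × K × K => !![(t.1 : K), t.2.1, t.2.2; 0, t.1, t.2.1; 0, 0, t.1]) ?_ ?_ ?_
  · rintro ⟨x, y, z⟩ ⟨x', y', z'⟩ h
    have h1 (i j : Fin 3) := congrFun (congrFun h i) j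
    exact Prod.ext (Units.ext (h1 0 0)) (Prod.ext (h1 0 1) (h1 0 2))
  · intro M
    change _ ↔ M * !![(a : K), 1, 0; 0, a, 1; 0, 0, a] = !![(a : K), 1, 0; 0, a, 1; 0, 0, a] * M ∧ _
    constructor
    · rintro ⟨⟨x, y, z⟩, rfl⟩
      refine ⟨?_, ?_⟩
      · ext i j
        fin_cases i <;> fin_cases j <;> simp [Matrix.mul_apply, Fin.sum_univ_three] <;> ring
      · simp [det_fin_three]
    · rintro ⟨hc, hd⟩
      have h1 (i j : Fin 3) := congrFun (congrFun hc i) j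
      simp only [Matrix.mul_apply, Fin.sum_univ_three] at h1
      have h00 := h1 0 0
      have h01 := h1 0 1
      have h02 := h1 0 2
      have h10 := h1 1 0
      have h11 := h1 1 1
      have h12 := h1 1 2
      simp at h00 h01 h02 h10 h11 h12
      replace h10' : M 1 0 = 0 := by linear_combination -h00
      replace h20 : M 2 0 = 0 := by linear_combination -h10
      replace h11' : M 1 1 = M 0 0 := by linear_combination -h01
      replace h21 : M 2 1 = 0 := by linear_combination h10' - h11
      replace h22 : M 2 2 = M 0 0 := by linear_combination h11' - h12
      replace h12' : M 1 2 = M 0 1 := by linear_combination -h02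
      rw [det_fin_three, h10', h11', h20, h21, h22] at hd
      have hd2 : M 0 0 ≠ 0 := by
        intro h
        apply hd
        rw [h]
        ring
      refine ⟨⟨Units.mk0 (M 0 0) hd2, M 0 1, M 0 2⟩, ?_⟩
      ext i j
      fin_cases i <;> fin_cases j <;> simp [h10', h11', h12', h20, h21, h22]
  · obtain ⟨k, hk⟩ := exists_natCard_eq_add_one (K := K)
    obtain ⟨h1, h2, h3, h4, h5, h6⟩ := sub_one_formulas k
    simp only [Nat.card_prod]
    rw [natCard_GL, natCard_units_field, hk, Fin.prod_univ_three, sizeP2]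
    simp only [Fin.val_zero, Fin.val_one, Fin.val_two, pow_zero, pow_one, h1, h2, h3, h5, h6]
    ring

theorem classSize_jordan21_of_ne [Finite K] {a b : Kˣ} (hab : a ≠ b) :
    classSize (jordan21 a b) = sizeP3 (Nat.card K) := by
  have hab' : (a : K) - b ≠ 0 := sub_ne_zero.2 fun h => hab (Units.ext h)
  refine classSize_eq_of_param _
    (fun t : Kˣ × Kˣ × K => !![(t.1 : K), t.2.2, 0; 0, t.1, 0; 0, 0, t.2.1]) ?_ ?_ ?_
  · rintro ⟨x, y, z⟩ ⟨x', y', z'⟩ h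
    have h1 (i j : Fin 3) := congrFun (congrFun h i) j
    exact Prod.ext (Units.ext (h1 0 0)) (Prod.ext (Units.ext (h1 2 2)) (h1 0 1))
  · intro M
    change _ ↔ M * !![(a : K), 1, 0; 0, a, 0; 0, 0, b] = !![(a : K), 1, 0; 0, a, 0; 0, 0, b] * M ∧ _
    constructor
    · rintro ⟨⟨x, y, z⟩, rfl⟩
      refine ⟨?_, ?_⟩
      · ext i j
        fin_cases i <;> fin_cases j <;> simp [Matrix.mul_apply, Fin.sum_univ_three] <;> ring
      · simp [det_fin_three]
    · rintro ⟨hc, hd⟩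
      have h1 (i j : Fin 3) := congrFun (congrFun hc i) j
      simp only [Matrix.mul_apply, Fin.sum_univ_three] at h1
      have h00 := h1 0 0
      have h01 := h1 0 1
      have h02 := h1 0 2
      have h12 := h1 1 2
      have h20 := h1 2 0
      have h21 := h1 2 1
      simp at h00 h01 h02 h12 h20 h21
      replace h10 : M 1 0 = 0 := by linear_combination -h00
      replace h11 : M 1 1 = M 0 0 := by linear_combination -h01
      replace h12 : M 1 2 = 0 := mul_right_cancel₀ hab' (by linear_combination -h12)
      replace h02 : M 0 2 = 0 := mul_right_cancel₀ hab' (by linear_combination -h02 - h12)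
      replace h20 : M 2 0 = 0 := mul_right_cancel₀ hab' (by linear_combination h20)
      replace h21 : M 2 1 = 0 := mul_right_cancel₀ hab' (by linear_combination h21 - h20)
      rw [det_fin_three, h10, h11, h02, h12, h20, h21] at hd
      have hd2 : M 0 0 * M 2 2 ≠ 0 := by
        intro h
        apply hd
        linear_combination M 0 0 * h
      refine ⟨⟨Units.mk0 (M 0 0) (left_ne_zero_of_mul hd2),
        Units.mk0 (M 2 2) (right_ne_zero_of_mul hd2), M 0 1⟩, ?_⟩
      ext i j
      fin_cases i <;> fin_cases j <;> simp [h10, h11, h02, h12, h20, h21]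
  · obtain ⟨k, hk⟩ := exists_natCard_eq_add_one (K := K)
    obtain ⟨h1, h2, h3, h4, h5, h6⟩ := sub_one_formulas k
    simp only [Nat.card_prod]
    rw [natCard_GL, natCard_units_field, hk, Fin.prod_univ_three, sizeP3]
    simp only [Fin.val_zero, Fin.val_one, Fin.val_two, pow_zero, pow_one, h1, h3, h5, h6]
    ring

end ClassSizes

end

section

/-! ### Sizes of the elliptic classes. -/

section EllipticClassSizes

variable {K : Type*} [Field K]

/-- If C is the companion matrix and g has coefficients v, then g(C)e₁ = v. As e₂ = Ce₁ and e₃ =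
C²e₁, the other columns of g(C) are Cv and C²v. -/
theorem krylov_companion3_eq_aeval (c v : Fin 3 → K) :
    krylov (companion3 c) v = Polynomial.aeval (companion3 c)
      (Polynomial.C (v 0) + Polynomial.C (v 1) * Polynomial.X +
        Polynomial.C (v 2) * Polynomial.X ^ 2) := by
  simp only [map_add, map_mul, Polynomial.aeval_C, Polynomial.aeval_X,
    Algebra.algebraMap_eq_smul_one, smul_mul_assoc, one_mul, sq]
  ext i j
  fin_cases i <;> fin_cases j <;>
    simp [krylov, companion3, Matrix.vecHead, Matrix.vecTail] <;> ring

theorem natDegree_charpoly_fin_three (A : Matrix (Fin 3) (Fin 3) K) :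
    A.charpoly.natDegree = 3 := by
  rw [charpoly_natDegree_eq_dim, Fintype.card_fin]

theorem irreducible_charpoly {A : Matrix (Fin 3) (Fin 3) K}
    (h : ∀ t, A.charpoly.eval t ≠ 0) : Irreducible A.charpoly :=
  Polynomial.irreducible_of_degree_le_three_of_not_isRoot
    (by rw [natDegree_charpoly_fin_three]; decide) h

/-- A Bézout relation between g and the characteristic polynomial, evaluated at A, exhibits an
inverse of g(A) by Cayley–Hamilton. -/
theorem det_aeval_ne_zero {A : Matrix (Fin 3) (Fin 3) K} (h : Irreducible A.charpoly)
    {g : Polynomial K} (hg : ¬ A.charpoly ∣ g) : (Polynomial.aeval A g).det ≠ 0 := by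
  obtain ⟨a, b, hab⟩ := (h.coprime_iff_not_dvd).2 hg
  have h1 := congrArg (Polynomial.aeval A) hab
  rw [map_add, map_mul, map_mul, aeval_self_charpoly, mul_zero, zero_add, map_one] at h1
  have h2 := congrArg det h1
  rw [det_mul, det_one] at h2
  exact right_ne_zero_of_mul (h2 ▸ one_ne_zero)

theorem det_krylov_companion3_ne_zero {c v : Fin 3 → K} (hv : v ≠ 0)
    (h : Irreducible (companion3 c).charpoly) : (krylov (companion3 c) v).det ≠ 0 := by
  rw [krylov_companion3_eq_aeval]
  refine det_aeval_ne_zero h fun hd => hv ?_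
  set g := Polynomial.C (v 0) + Polynomial.C (v 1) * Polynomial.X +
    Polynomial.C (v 2) * Polynomial.X ^ 2 with hg
  have hdeg : g.natDegree ≤ 2 := by
    rw [hg]
    compute_degree
  have hg0 : g = 0 := Polynomial.eq_zero_of_dvd_of_natDegree_lt hd
    (by rw [natDegree_charpoly_fin_three]; omega)
  funext i
  have := congrArg (fun f => Polynomial.coeff f i) hg0
  rw [hg] at this
  fin_cases i <;>
    simpa [Polynomial.coeff_X, Polynomial.coeff_C, Polynomial.coeff_X_pow] using this

theorem krylov_companion3_single (c : Fin 3 → K) : krylov (companion3 c) ![1, 0, 0] = 1 := by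
  ext i j
  fin_cases i <;> fin_cases j <;>
    simp [krylov, companion3, Matrix.vecHead, Matrix.vecTail]

theorem hasCyclicVector_of_eval_ne_zero {γ : GL3 K} (h : ∀ t, γ.1.charpoly.eval t ≠ 0) :
    HasCyclicVector γ.1 := by
  by_contra hn
  rcases isConj_standard_of_not_hasCyclicVector hn with ⟨a, b, hc⟩ | ⟨a, hc⟩
  · refine h a ?_
    rw [← charpoly_eq_of_isConj hc, charpoly_diag3, eval_cubic]
    ring
  · refine h a ?_
    rw [← charpoly_eq_of_isConj hc, charpoly_jordan21, eval_cubic]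
    ring

/-- After passing to the companion matrix C, the centralizer is K[C] without 0, a cubic field
without 0. Its elements correspond to their first columns, the q³ - 1 nonzero vectors. -/
theorem classSize_of_irreducible_charpoly [Finite K] {γ : GL3 K}
    (h : ∀ t, γ.1.charpoly.eval t ≠ 0) : classSize γ = sizeE2 (Nat.card K) := by
  obtain ⟨v, hv⟩ := hasCyclicVector_of_eval_ne_zero h
  obtain ⟨c, hc⟩ := exists_mul_krylov hv
  have hcp := charpoly_eq_of_mul_eq hv hc
  have hirr := irreducible_charpoly h
  rw [hcp] at hirr
  have hdet : (companion3 c).det ≠ 0 := by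
    have h2 := congrArg det hc
    rw [det_mul, det_mul, mul_comm] at h2
    rw [← mul_left_cancel₀ hv h2]
    exact ((Matrix.isUnit_iff_isUnit_det _).1 γ.isUnit).ne_zero
  rw [classSize_eq_of_isConj (h := GeneralLinearGroup.mkOfDetNeZero _ hdet)
    (isConj_iff_exists_matrix.2 ⟨_, hv, hc⟩)]
  refine classSize_eq_of_param _
    (fun w : {w : Fin 3 → K // w ≠ 0} => krylov (companion3 c) w.1) ?_ ?_ ?_
  · intro w w' hw
    exact Subtype.ext (funext fun i => congrFun (congrFun hw i) 0)
  · intro M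
    change _ ↔ M * companion3 c = companion3 c * M ∧ _
    constructor
    · rintro ⟨w, rfl⟩
      refine ⟨?_, det_krylov_companion3_ne_zero w.2 hirr⟩
      simp only [krylov_companion3_eq_aeval]
      have hcomm (g : Polynomial K) := (Commute.all g Polynomial.X).map
        (Polynomial.aeval (companion3 c))
      simp only [Polynomial.aeval_X] at hcomm
      exact hcomm _
    · rintro ⟨hM, hd⟩
      refine ⟨⟨M *ᵥ ![1, 0, 0], fun h0 => ?_⟩, ?_⟩
      · have h1 : (![1, 0, 0] : Fin 3 → K) = 0 := eq_zero_of_mulVec_eq_zero hd h0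
        exact one_ne_zero (congrFun h1 0)
      · change krylov (companion3 c) (M *ᵥ ![1, 0, 0]) = M
        rw [krylov_mulVec hM.symm, krylov_companion3_single, mul_one]
  · obtain ⟨k, hk⟩ := exists_natCard_eq_add_one (K := K)
    obtain ⟨h1, h2, h3, h4, h5, h6⟩ := sub_one_formulas k
    have hT : Nat.card {w : Fin 3 → K // w ≠ 0} = (k + 1) ^ 3 - 1 := by
      have := Fintype.ofFinite K
      classical
      rw [Nat.card_eq_fintype_card, Fintype.card_subtype_compl, Fintype.card_subtype_eq,
        Fintype.card_fun, Fintype.card_fin, ← Nat.card_eq_fintype_card, hk]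
    rw [hT, natCard_GL, hk, Fin.prod_univ_three, sizeE2]
    simp only [Fin.val_zero, Fin.val_one, Fin.val_two, pow_zero, pow_one, h1, h3, h5, h6]
    ring

/-- A non-cyclic matrix has a double eigenvalue a in K. It must equal r, and its second occurrence
would be a root of g. -/
theorem hasCyclicVector_of_charpoly_eq_mul {γ : GL3 K} {r : K} {g : Polynomial K}
    (h : γ.1.charpoly = (Polynomial.X - Polynomial.C r) * g) (hg : ∀ t, g.eval t ≠ 0) :
    HasCyclicVector γ.1 := by
  by_contra hn
  have key (a b : K) (h2 : γ.1.charpoly = cubic a a b) : False := by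
    rw [h] at h2
    have h3 := congrArg (Polynomial.eval a) h2
    rw [eval_cubic, Polynomial.eval_mul, sub_self, zero_mul, zero_mul] at h3
    obtain rfl : a = r := by
      have := (mul_eq_zero.1 h3).resolve_right (hg a)
      simpa [sub_eq_zero] using this
    rw [cubic, mul_assoc] at h2
    have h4 := mul_left_cancel₀ (Polynomial.X_sub_C_ne_zero a) h2
    apply hg a
    simp [h4]
  rcases isConj_standard_of_not_hasCyclicVector hn with ⟨a, b, hc⟩ | ⟨a, hc⟩
  · exact key a b (by rw [← charpoly_eq_of_isConj hc, charpoly_diag3])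
  · exact key a a (by rw [← charpoly_eq_of_isConj hc, charpoly_jordan21])

/-- γ is conjugate to the block sum of the companion matrix of g and r. Its centralizer is the
product of the multiplicative groups of K[X]/(g) and K. -/
theorem classSize_of_charpoly_eq_mul [Finite K] {γ : GL3 K} {r : K} {g : Polynomial K}
    (h : γ.1.charpoly = (Polynomial.X - Polynomial.C r) * g) (hg : ∀ t, g.eval t ≠ 0) :
    classSize γ = sizeE1 (Nat.card K) := by
  have hmon : g.Monic := Polynomial.Monic.of_mul_monic_left (Polynomial.monic_X_sub_C r)
    (h ▸ γ.1.charpoly_monic)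
  have hdeg : g.natDegree = 2 := by
    have := natDegree_charpoly_fin_three γ.1
    rw [h, (Polynomial.monic_X_sub_C r).natDegree_mul hmon, Polynomial.natDegree_X_sub_C] at this
    omega
  obtain ⟨c₀, c₁, hquad⟩ : ∃ c₀ c₁, g = Polynomial.X ^ 2 - Polynomial.C c₁ * Polynomial.X -
      Polynomial.C c₀ := by
    refine ⟨-g.coeff 0, -g.coeff 1, ?_⟩
    have h2 : g.coeff 2 = 1 := by
      have := hmon.coeff_natDegree
      rwa [hdeg] at this
    ext i
    rcases i with _ | _ | _ | i
    · simp
    · simp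
    · simp [h2]
    · rw [Polynomial.coeff_eq_zero_of_natDegree_lt (by omega)]
      simp [Polynomial.coeff_X_pow]
  have hq (t : K) : t ^ 2 - c₁ * t - c₀ ≠ 0 := by
    have := hg t
    rw [hquad] at this
    simpa using this
  have hr : r ≠ 0 := by
    rintro rfl
    have h1 := Matrix.det_eq_sign_charpoly_coeff γ.1
    rw [h] at h1
    simp at h1
    exact ((Matrix.isUnit_iff_isUnit_det _).1 γ.isUnit).ne_zero h1
  have hc₀ : c₀ ≠ 0 := by
    have := hq 0
    simpa using this
  have hdet : (!![0, c₀, 0; 1, c₁, 0; 0, 0, r]).det ≠ 0 := by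
    simp [det_fin_three, hr, hc₀]
  set β : GL3 K := GeneralLinearGroup.mkOfDetNeZero _ hdet with hβ
  have hβv : β.1 = !![0, c₀, 0; 1, c₁, 0; 0, 0, r] := rfl
  have hβc : β.1.charpoly = (Polynomial.X - Polynomial.C r) * g := by
    rw [hquad, hβv]
    simp only [Matrix.charpoly, Matrix.det_fin_three, charmatrix_apply]
    simp
    ring
  rw [classSize_eq_of_isConj (isConj_of_charpoly_eq (hasCyclicVector_of_charpoly_eq_mul h hg)
    (hasCyclicVector_of_charpoly_eq_mul hβc hg) (h.trans hβc.symm))]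
  -- This is the norm form of the quadratic field K[X]/(g); a nontrivial zero would give the root
  -- -x/y of g.
  have hnorm (x y : K) (hxy : (x, y) ≠ 0) : x * (x + c₁ * y) - c₀ * y * y ≠ 0 := by
    intro h0
    by_cases hy : y = 0
    · subst hy
      apply hxy
      simpa using h0
    · apply hq (-(x / y))
      field_simp
      linear_combination h0
  refine classSize_eq_of_param _
    (fun t : {t : K × K // t ≠ 0} × Kˣ =>
      !![t.1.1.1, c₀ * t.1.1.2, 0; t.1.1.2, t.1.1.1 + c₁ * t.1.1.2, 0; 0, 0, (t.2 : K)]) ?_ ?_ ?_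
  · rintro ⟨⟨⟨x, y⟩, _⟩, z⟩ ⟨⟨⟨x', y'⟩, _⟩, z'⟩ h
    have h1 (i j : Fin 3) := congrFun (congrFun h i) j
    exact Prod.ext (Subtype.ext (Prod.ext (h1 0 0) (h1 1 0))) (Units.ext (h1 2 2))
  · intro M
    rw [hβv]
    constructor
    · rintro ⟨⟨⟨⟨x, y⟩, hxy⟩, z⟩, rfl⟩
      refine ⟨?_, ?_⟩
      · ext i j
        fin_cases i <;> fin_cases j <;> simp [Matrix.mul_apply, Fin.sum_univ_three] <;> ring
      · have := mul_ne_zero (hnorm x y hxy) z.ne_zero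
        simp [det_fin_three]
        intro h
        apply this
        linear_combination h
    · rintro ⟨hc, hd⟩
      have h1 (i j : Fin 3) := congrFun (congrFun hc i) j
      simp only [Matrix.mul_apply, Fin.sum_univ_three] at h1
      have h00 := h1 0 0
      have h10 := h1 1 0
      have h02 := h1 0 2
      have h12 := h1 1 2
      have h20 := h1 2 0
      have h21 := h1 2 1
      simp at h00 h10 h02 h12 h20 h21
      -- A nonzero off-diagonal block would intertwine the companion matrix of g with r, which
      -- requires g(r) = 0.
      replace h12' : M 1 2 = 0 := mul_right_cancel₀ (hq r) (by
        linear_combination r * h12 + h02)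
      replace h02' : M 0 2 = 0 := by linear_combination r * h12' - h12 - c₁ * h12'
      replace h20' : M 2 0 = 0 := mul_right_cancel₀ (hq r) (by
        linear_combination -(r - c₁) * h20 - h21)
      replace h21' : M 2 1 = 0 := by linear_combination h20 + r * h20'
      rw [det_fin_three, h02', h12', h20', h21'] at hd
      have hd2 : (M 0 0 * M 1 1 - M 0 1 * M 1 0) * M 2 2 ≠ 0 := by
        intro h
        apply hd
        linear_combination h
      refine ⟨⟨⟨(M 0 0, M 1 0), fun h0 => ?_⟩, Units.mk0 (M 2 2) (right_ne_zero_of_mul hd2)⟩, ?_⟩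
      · apply hd2
        obtain ⟨h3, h4⟩ := Prod.mk.inj h0
        rw [h3, h4]
        ring
      · ext i j
        fin_cases i <;> fin_cases j <;> simp [h02', h12', h20', h21', h00, h10]
  · obtain ⟨k, hk⟩ := exists_natCard_eq_add_one (K := K)
    obtain ⟨h1, h2, h3, h4, h5, h6⟩ := sub_one_formulas k
    have hT : Nat.card {w : K × K // w ≠ 0} = (k + 1) ^ 2 - 1 := by
      have := Fintype.ofFinite K
      classical
      rw [Nat.card_eq_fintype_card, Fintype.card_subtype_compl, Fintype.card_subtype_eq,
        Fintype.card_prod, ← Nat.card_eq_fintype_card, hk, sq]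
    rw [Nat.card_prod, hT, natCard_GL, natCard_units_field, hk, Fin.prod_univ_three, sizeE1]
    simp only [Fin.val_zero, Fin.val_one, Fin.val_two, pow_zero, pow_one, h1, h2, h3, h5, h6]
    ring

variable {L : Type*} [Field L] [Finite K]

theorem classSize_of_charpoly_map_of_notMem {f : K →+* L} {γ : GL3 K} {x y z : L}
    (h : γ.1.charpoly.map f = cubic x y z) (hx : x ∉ f.range) (hy : y ∉ f.range)
    (hz : z ∉ f.range) : classSize γ = sizeE2 (Nat.card K) := by
  refine classSize_of_irreducible_charpoly fun t ht => ?_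
  have h1 : (γ.1.charpoly.map f).eval (f t) = 0 := by
    rw [Polynomial.eval_map_apply, ht, map_zero]
  rw [h, eval_cubic] at h1
  have h2 (w : L) (hw : w ∉ f.range) : f t - w ≠ 0 := fun h0 => hw ⟨t, sub_eq_zero.1 h0⟩
  exact mul_ne_zero (mul_ne_zero (h2 x hx) (h2 y hy)) (h2 z hz) h1

theorem classSize_of_charpoly_map_of_mem {f : K →+* L} {γ : GL3 K} {x y : L} {r : K}
    (h : γ.1.charpoly.map f = cubic x y (f r)) (hx : x ∉ f.range) (hy : y ∉ f.range) :
    classSize γ = sizeE1 (Nat.card K) := by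
  have h0 : γ.1.charpoly.eval r = 0 := by
    apply f.injective
    rw [← Polynomial.eval_map_apply, h, eval_cubic]
    simp
  obtain ⟨g, hg⟩ := Polynomial.dvd_iff_isRoot.2 h0
  refine classSize_of_charpoly_eq_mul hg fun t ht => ?_
  have h1 : g.map f = (Polynomial.X - Polynomial.C x) * (Polynomial.X - Polynomial.C y) := by
    refine mul_left_cancel₀ (Polynomial.X_sub_C_ne_zero (f r)) ?_
    have h2 := h
    rw [hg, Polynomial.map_mul] at h2
    simp only [Polynomial.map_sub, Polynomial.map_X, Polynomial.map_C, cubic] at h2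
    rw [h2]
    ring
  have h3 : (g.map f).eval (f t) = 0 := by
    rw [Polynomial.eval_map_apply, ht, map_zero]
  rw [h1] at h3
  have h2 (w : L) (hw : w ∉ f.range) : f t - w ≠ 0 := fun h0 => hw ⟨t, sub_eq_zero.1 h0⟩
  simp only [Polynomial.eval_mul, Polynomial.eval_sub, Polynomial.eval_X, Polynomial.eval_C] at h3
  exact mul_ne_zero (h2 x hx) (h2 y hy) h3

end EllipticClassSizes

end

section

/-! ### Frobenius action on eigenvalues and fields of definition. -/

section Frobenius

variable {k L : Type*} [Field k] [Field L]

/-- X^|k| - X already splits over k, so it acquires no new roots in L. -/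
theorem mem_range_iff_pow_natCard_eq [Finite k] (i : k →+* L) (x : L) :
    x ∈ i.range ↔ x ^ Nat.card k = x := by
  have := Fintype.ofFinite k
  constructor
  · rintro ⟨y, rfl⟩
    rw [← map_pow, Nat.card_eq_fintype_card, FiniteField.pow_card]
  · intro hx
    rw [Nat.card_eq_fintype_card] at hx
    have h0 : (Polynomial.X ^ Fintype.card k - Polynomial.X : Polynomial k) ≠ 0 :=
      FiniteField.X_pow_card_sub_X_ne_zero k Fintype.one_lt_card
    have hs : (Polynomial.X ^ Fintype.card k - Polynomial.X : Polynomial k).Splits := by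
      rw [Polynomial.splits_iff_card_roots, FiniteField.roots_X_pow_card_sub_X,
        FiniteField.X_pow_card_sub_X_natDegree_eq k Fintype.one_lt_card]
      rfl
    have h2 : x ∈ ((Polynomial.X ^ Fintype.card k - Polynomial.X : Polynomial k).map i).roots := by
      rw [Polynomial.mem_roots (Polynomial.map_ne_zero h0)]
      simp [hx]
    rw [hs.roots_map, Multiset.mem_map] at h2
    obtain ⟨y, -, hy⟩ := h2
    exact ⟨y, hy⟩

variable {p m : ℕ} [Fact p.Prime] [CharP L p]

theorem pow_pow_injective {x y : L} (h : x ^ p ^ m = y ^ p ^ m) : x = y := by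
  apply (iterateFrobenius L p m).injective
  simpa [iterateFrobenius_def] using h

omit [Fact p.Prime] [CharP L p] in
theorem pow_pow_mul_eq_self {x : L} {a : ℕ} (h : x ^ p ^ a = x) (b : ℕ) :
    x ^ p ^ (a * b) = x := by
  induction b with
  | zero => simp
  | succ b ih => rw [mul_add, mul_one, pow_add, pow_mul, ih, h]

/-- The |k|-power map fixes the coefficients of a polynomial over k, hence permutes its roots with
multiplicity. -/
theorem cubic_pow_of_map_eq [Finite k] (hk : Nat.card k = p ^ m) {i : k →+* L}
    {f : Polynomial k} {x y z : L} (h : f.map i = cubic x y z) :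
    cubic (x ^ p ^ m) (y ^ p ^ m) (z ^ p ^ m) = cubic x y z := by
  have h1 : (iterateFrobenius L p m).comp i = i := by
    ext a
    rw [RingHom.comp_apply, iterateFrobenius_def, ← hk]
    exact (mem_range_iff_pow_natCard_eq i (i a)).1 ⟨a, rfl⟩
  have h2 := congrArg (Polynomial.map (iterateFrobenius L p m)) h
  rw [Polynomial.map_map, h1, map_cubic, h] at h2
  simpa only [iterateFrobenius_def] using h2.symm

theorem charpoly_companion3_eq_cubic (x y z : L) :
    (companion3 ![x * y * z, -(x * y + y * z + z * x), x + y + z]).charpoly = cubic x y z := by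
  rw [charpoly_companion3]
  simp only [cubic, Matrix.cons_val, map_neg, map_add, map_mul]
  ring

/-- Galois descent: the coefficients of a Frobenius-stable cubic are Frobenius-fixed, so they lie in
k, where the companion matrix realizes them. Nonzero roots make it invertible. -/
theorem exists_charpoly_map_eq_cubic [Finite k] (hk : Nat.card k = p ^ m) (i : k →+* L)
    {x y z : L} (h : cubic (x ^ p ^ m) (y ^ p ^ m) (z ^ p ^ m) = cubic x y z)
    (hx : x ≠ 0) (hy : y ≠ 0) (hz : z ≠ 0) :
    ∃ δ : GL3 k, HasCyclicVector δ.1 ∧ δ.1.charpoly.map i = cubic x y z := by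
  rw [← charpoly_companion3_eq_cubic, ← charpoly_companion3_eq_cubic x] at h
  have h1 := charpoly_companion3_injective h
  -- Frobenius is a ring homomorphism, so it sends each coefficient to the same expression in the
  -- powered roots, which is unchanged by assumption.
  have h2 (j : Fin 3) : (![x * y * z, -(x * y + y * z + z * x), x + y + z] j) ^ p ^ m =
      ![x * y * z, -(x * y + y * z + z * x), x + y + z] j := by
    rw [← congrFun h1 j, ← iterateFrobenius_def]
    rw [congrFun h1 j]
    conv_rhs => rw [← congrFun h1 j]
    simp only [← iterateFrobenius_def (R := L) p m]
    fin_cases j <;> simp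
  have h3 (j : Fin 3) : ∃ a, i a = ![x * y * z, -(x * y + y * z + z * x), x + y + z] j :=
    (mem_range_iff_pow_natCard_eq i _).2 (by rw [hk, h2])
  choose c hc using h3
  have hdet : (companion3 c).det ≠ 0 := by
    have h4 : i (c 0) ≠ 0 := by
      rw [hc]
      exact mul_ne_zero (mul_ne_zero hx hy) hz
    simpa [companion3, det_fin_three] using h4
  refine ⟨GeneralLinearGroup.mkOfDetNeZero _ hdet, hasCyclicVector_companion3 c, ?_⟩
  change (companion3 c).charpoly.map i = _
  rw [← charpoly_companion3_eq_cubic, ← funext hc, charpoly_companion3, charpoly_companion3]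
  simp

theorem ne_zero_of_charpoly_map_eq_cubic {γ : GL3 k} {i : k →+* L} {x y z : L}
    (h : γ.1.charpoly.map i = cubic x y z) : x ≠ 0 ∧ y ≠ 0 ∧ z ≠ 0 := by
  have h1 : γ.1.charpoly.eval 0 ≠ 0 := by
    have := ((Matrix.isUnit_iff_isUnit_det _).1 γ.isUnit).ne_zero
    rw [Matrix.det_eq_sign_charpoly_coeff, Polynomial.coeff_zero_eq_eval_zero] at this
    exact right_ne_zero_of_mul this
  have h2 : (γ.1.charpoly.map i).eval (i 0) ≠ 0 := by
    rw [Polynomial.eval_map_apply]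
    exact (map_ne_zero i).2 h1
  rw [h, eval_cubic, map_zero] at h2
  simpa [and_assoc] using h2

theorem exists_charpoly_map_eq [IsAlgClosed L] (γ : GL3 k) (i : k →+* L) :
    ∃ x y z, γ.1.charpoly.map i = cubic x y z := by
  have hm : (γ.1.charpoly.map i).Monic := (γ.1.charpoly_monic).map i
  have hs := IsAlgClosed.splits (γ.1.charpoly.map i)
  have hc : (γ.1.charpoly.map i).roots.card = 3 := by
    rw [Polynomial.splits_iff_card_roots.1 hs, Polynomial.natDegree_map,
      natDegree_charpoly_fin_three]
  obtain ⟨x, y, z, h⟩ := Multiset.card_eq_three.1 hc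
  refine ⟨x, y, z, ?_⟩
  rw [cubic_eq, ← h]
  exact hs.eq_prod_roots_of_monic hm

end Frobenius

/-! ### Galois orbits of eigenvalues outside F. -/

section Classification

variable {p n : ℕ} [Fact p.Prime] {F : Type*} [Field F] [Finite F]
  {L : Type*} [Field L] [CharP L p]

omit [Finite F] in
theorem cubic_swap_right (x y z : F) : cubic x y z = cubic x z y := by
  simp only [cubic]
  ring

omit [Fact p.Prime] [CharP L p] in
-- A double root is unique among three roots, so Frobenius would have to fix it.
theorem ne_of_cubic_pow_eq {x y z : L}
    (hst : cubic (x ^ p ^ n) (y ^ p ^ n) (z ^ p ^ n) = cubic x y z) (hx : x ^ p ^ n ≠ x) :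
    x ≠ y := by
  rintro rfl
  exact hx (eq_and_eq_of_cubic_eq hst).1

/-- A permutation of three elements without fixed points is a 3-cycle; one value determines it. -/
theorem cycle_of_cubic_pow_eq {x y z : L}
    (hst : cubic (x ^ p ^ n) (y ^ p ^ n) (z ^ p ^ n) = cubic x y z)
    (hy : y ^ p ^ n ≠ y) (hz : z ^ p ^ n ≠ z) (hyz : y ≠ z)
    (hzx : z ≠ x) (h1 : x ^ p ^ n = y) : y ^ p ^ n = z ∧ z ^ p ^ n = x := by
  have hinj {a b : L} (h : a ≠ b) : a ^ p ^ n ≠ b ^ p ^ n := fun h0 => h (pow_pow_injective h0)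
  have hz2 : z ^ p ^ n = x := by
    rcases eq_or_eq_or_eq_of_cubic_eq ((cubic_rotate _ _ _).trans hst) with h | h | h
    · exact h
    · exact absurd (h.trans h1.symm) (hinj hzx)
    · exact absurd h hz
  refine ⟨?_, hz2⟩
  rcases eq_or_eq_or_eq_of_cubic_eq ((cubic_swap _ _ _).trans hst) with h | h | h
  · exact absurd (h.trans hz2.symm) (hinj hyz)
  · exact absurd h hy
  · exact h

theorem exists_cubic_conjugates (hF : Nat.card F = p ^ n) {g : F →+* L} {f : Polynomial F}
    {x y z : L} (h : f.map g = cubic x y z) (hf : ∀ t, f.eval t ≠ 0) :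
    ∃ w, w ^ p ^ (3 * n) = w ∧ w ^ p ^ n ≠ w ∧ (w ^ p ^ n) ^ p ^ n ≠ w ∧
      f.map g = cubic w (w ^ p ^ n) ((w ^ p ^ n) ^ p ^ n) := by
  have hst := cubic_pow_of_map_eq hF h
  have hroot (t : L) (ht : (cubic x y z).eval t = 0) : t ^ p ^ n ≠ t := by
    intro h1
    rw [← hF] at h1
    obtain ⟨s, rfl⟩ := (mem_range_iff_pow_natCard_eq g t).2 h1
    rw [← h, Polynomial.eval_map_apply, map_eq_zero] at ht
    exact hf s ht
  have hx := hroot x (by simp [eval_cubic])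
  have hy := hroot y (by simp [eval_cubic])
  have hz := hroot z (by simp [eval_cubic])
  have hst2 := (cubic_rotate _ _ _).symm.trans (hst.trans (cubic_rotate _ _ _))
  have hxy : x ≠ y := ne_of_cubic_pow_eq hst hx
  have hyz : y ≠ z := ne_of_cubic_pow_eq hst2 hy
  have hzx : z ≠ x := ne_of_cubic_pow_eq
    ((cubic_rotate _ _ _).symm.trans (hst2.trans (cubic_rotate _ _ _))) hz
  have key {x y z : L} (h : f.map g = cubic x y z) (hxy : x ≠ y) (hzx : z ≠ x)
      (h1 : x ^ p ^ n = y) (h2 : y ^ p ^ n = z) (h3 : z ^ p ^ n = x) :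
      ∃ w, w ^ p ^ (3 * n) = w ∧ w ^ p ^ n ≠ w ∧ (w ^ p ^ n) ^ p ^ n ≠ w ∧
      f.map g = cubic w (w ^ p ^ n) ((w ^ p ^ n) ^ p ^ n) := by
    refine ⟨x, ?_, ?_, ?_, ?_⟩
    · rw [show 3 * n = n + n + n by ring, pow_add, pow_add, pow_mul, pow_mul, h1, h2, h3]
    · rw [h1]; exact hxy.symm
    · rw [h1, h2]; exact hzx
    · rw [h1, h2, h]
  rcases eq_or_eq_or_eq_of_cubic_eq hst with h1 | h1 | h1
  · exact absurd h1 hx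
  · obtain ⟨h2, h3⟩ := cycle_of_cubic_pow_eq hst hy hz hyz hzx h1
    exact key h hxy hzx h1 h2 h3
  -- The opposite orientation of the 3-cycle reduces to the previous case by exchanging y and z.
  · obtain ⟨h2, h3⟩ := cycle_of_cubic_pow_eq
      ((cubic_swap_right _ _ _).trans (hst.trans (cubic_swap_right _ _ _)))
      hz hy hyz.symm hxy.symm h1
    exact key (h.trans (cubic_swap_right _ _ _)) hzx.symm hxy.symm h1 h2 h3

/-- Frobenius fixes the root in F and neither of the others, so it exchanges these two. -/
theorem exists_quadratic_conjugates (hF : Nat.card F = p ^ n) {g : F →+* L}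
    {f : Polynomial F} {r : F} {x y : L}
    (h : ((Polynomial.X - Polynomial.C r) * f).map g = cubic x y (g r))
    (hf : ∀ t, f.eval t ≠ 0) : x ^ p ^ (2 * n) = x ∧ x ^ p ^ n ≠ x ∧ y = x ^ p ^ n := by
  have h1 : f.map g = (Polynomial.X - Polynomial.C x) * (Polynomial.X - Polynomial.C y) := by
    refine mul_left_cancel₀ (Polynomial.X_sub_C_ne_zero (g r)) ?_
    rw [Polynomial.map_mul] at h
    simp only [Polynomial.map_sub, Polynomial.map_X, Polynomial.map_C, cubic] at h
    rw [h]
    ring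
  have hroot (t : L) (ht : (f.map g).eval t = 0) : t ^ p ^ n ≠ t := by
    intro h1
    rw [← hF] at h1
    obtain ⟨s, rfl⟩ := (mem_range_iff_pow_natCard_eq g t).2 h1
    rw [Polynomial.eval_map_apply, map_eq_zero] at ht
    exact hf s ht
  have hx := hroot x (by simp [h1])
  have hy := hroot y (by simp [h1])
  have hr : g r ^ p ^ n = g r := by
    rw [← hF]
    exact (mem_range_iff_pow_natCard_eq g _).1 ⟨r, rfl⟩
  have hst := cubic_pow_of_map_eq hF h
  have hne {t : L} (ht : t ^ p ^ n ≠ t) : t ^ p ^ n ≠ g r := by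
    intro h0
    apply ht
    rw [← hr] at h0
    rw [pow_pow_injective h0, hr]
  have h2 : x ^ p ^ n = y := by
    rcases eq_or_eq_or_eq_of_cubic_eq hst with h | h | h
    exacts [absurd h hx, h, absurd h (hne hx)]
  have h3 : y ^ p ^ n = x := by
    rcases eq_or_eq_or_eq_of_cubic_eq ((cubic_swap _ _ _).trans hst) with h | h | h
    exacts [h, absurd h hy, absurd h (hne hy)]
  refine ⟨?_, hx, h2.symm⟩
  rw [show 2 * n = n + n by ring, pow_add, pow_mul, h2, h3]

end Classification

end

/-! ### Which classes meet Γ, and the character on classes with eigenvalues in F. -/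

section

theorem mem_Fpow_one_iff {p : ℕ} {K : Type*} [Field K] {x : K} : x ∈ Fpow p 1 K ↔ x ^ p = x := by
  simp [Fpow]

theorem ind_of_mem {X : Type*} {S : Set X} {x : X} (h : x ∈ S) : ind S x = 1 := by
  simp [ind, h]

theorem ind_of_notMem {X : Type*} {S : Set X} {x : X} (h : x ∉ S) : ind S x = 0 := by
  simp [ind, h]

variable {p n : ℕ} [Fact p.Prime] {F : Type*} [Field F] [Algebra (ZMod p) F]

theorem charP_of_algebra_zmod : CharP F p :=
  charP_of_injective_algebraMap (algebraMap (ZMod p) F).injective p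

section PrimeField

variable {L : Type*} [Field L] [CharP L p]

/-- The necessary condition for a class to meet Γ. The second conclusion gives the eigenvalues of δ,
from which its class size in Γ is read off. -/
theorem cubic_pow_of_isConj_incl {γ : GL3 F} {δ : GL3 (ZMod p)} (h : IsConj γ (incl p F δ))
    {g : F →+* L} {x y z : L} (hγ : γ.1.charpoly.map g = cubic x y z) :
    cubic (x ^ p) (y ^ p) (z ^ p) = cubic x y z ∧
      δ.1.charpoly.map (g.comp (algebraMap (ZMod p) F)) = cubic x y z := by
  have h1 : δ.1.charpoly.map (g.comp (algebraMap (ZMod p) F)) = cubic x y z := by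
    rw [← hγ, charpoly_eq_of_isConj h, charpoly_mapGL, Polynomial.map_map]
  have h2 := cubic_pow_of_map_eq (p := p) (m := 1) (by simp) h1
  rw [pow_one] at h2
  exact ⟨h2, h1⟩

/-- The converse for cyclic γ: a cyclic matrix over 𝔽_p with the same characteristic polynomial
exists by descent, and it must be conjugate to γ. -/
theorem exists_isConj_incl {γ : GL3 F} (hc : HasCyclicVector γ.1) {g : F →+* L} {x y z : L}
    (hγ : γ.1.charpoly.map g = cubic x y z) (h : cubic (x ^ p) (y ^ p) (z ^ p) = cubic x y z) :
    ∃ δ : GL3 (ZMod p), IsConj γ (incl p F δ) := by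
  obtain ⟨hx, hy, hz⟩ := ne_zero_of_charpoly_map_eq_cubic hγ
  obtain ⟨δ, hδ, hδc⟩ := exists_charpoly_map_eq_cubic (k := ZMod p) (p := p) (m := 1) (by simp)
    (g.comp (algebraMap (ZMod p) F)) (by rwa [pow_one]) hx hy hz
  refine ⟨δ, isConj_of_charpoly_eq hc (hasCyclicVector_mapGL hδ) ?_⟩
  rw [charpoly_mapGL]
  apply Polynomial.map_injective g g.injective
  rw [Polynomial.map_map, hδc, hγ]

omit [CharP L p] in
theorem mem_range_zmod_iff (j : ZMod p →+* L) (x : L) : x ∈ j.range ↔ x ^ p = x := by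
  rw [mem_range_iff_pow_natCard_eq, Nat.card_zmod]

end PrimeField

variable [Finite F]

theorem chi_eq_of_isConj_incl {γ : GL3 F} {δ : GL3 (ZMod p)} (h : IsConj γ (incl p F δ)) :
    chi p F γ = idx p F * ((classSize δ : ℂ) / classSize γ) :=
  chi_eq_of_isConj (fun _ _ => isConj_of_isConj_mapGL _) h

omit [Finite F] in
theorem exists_units_map_eq {a : Fˣ} (h : (a : F) ^ p = a) :
    ∃ a₀ : (ZMod p)ˣ, Units.map (algebraMap (ZMod p) F : ZMod p →* F) a₀ = a := by
  have := charP_of_algebra_zmod (p := p) (F := F)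
  obtain ⟨b, hb⟩ := (mem_range_zmod_iff (algebraMap (ZMod p) F) (a : F)).2 h
  have hb0 : b ≠ 0 := by
    rintro rfl
    rw [map_zero] at hb
    exact a.ne_zero hb.symm
  exact ⟨Units.mk0 b hb0, Units.ext hb⟩

omit [Finite F] in
-- Frobenius preserves multiplicities, so it fixes the repeated eigenvalue and the remaining one.
theorem pow_eq_of_isConj_incl {γ : GL3 F} {δ : GL3 (ZMod p)} (h : IsConj γ (incl p F δ))
    {a b : F} (hγ : γ.1.charpoly = cubic a a b) : a ^ p = a ∧ b ^ p = b := by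
  have := charP_of_algebra_zmod (p := p) (F := F)
  exact eq_and_eq_of_cubic_eq (cubic_pow_of_isConj_incl h (g := RingHom.id F)
    (by rw [Polynomial.map_id, hγ])).1

theorem central_class {a : Fˣ} {γ : GL3 F} (h : IsConj (diag3 ![a, a, a]) γ) :
    classSize γ = 1 ∧ chi p F γ = idx p F * ind (Fpow p 1 F) (a : F) := by
  have hs : classSize γ = 1 := by rw [← classSize_eq_of_isConj h, classSize_diag3_scalar]
  refine ⟨hs, ?_⟩
  by_cases ha : (a : F) ^ p = a
  · obtain ⟨a₀, rfl⟩ := exists_units_map_eq ha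
    rw [ind_of_mem (mem_Fpow_one_iff.2 ha),
      chi_eq_of_isConj_incl (δ := diag3 ![a₀, a₀, a₀]) (by rw [mapGL_diag3]; exact h.symm),
      hs, classSize_diag3_scalar]
    simp
  · rw [ind_of_notMem (fun h0 => ha (mem_Fpow_one_iff.1 h0)), chi_eq_zero, mul_zero]
    intro δ hδ
    exact ha (pow_eq_of_isConj_incl hδ (by rw [← charpoly_eq_of_isConj h, charpoly_diag3])).1

theorem parabolic1_class (hF : Nat.card F = p ^ n) {a : Fˣ} {γ : GL3 F}
    (h : IsConj (jordan21 a a) γ) :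
    classSize γ = sizeP1 (p ^ n) ∧
      chi p F γ = idx p F * ((sizeP1 p : ℂ) / (sizeP1 (p ^ n) : ℂ)) *
        ind (Fpow p 1 F) (a : F) := by
  have hs : classSize γ = sizeP1 (p ^ n) := by
    rw [← classSize_eq_of_isConj h, classSize_jordan21_self, hF]
  refine ⟨hs, ?_⟩
  by_cases ha : (a : F) ^ p = a
  · obtain ⟨a₀, rfl⟩ := exists_units_map_eq ha
    rw [ind_of_mem (mem_Fpow_one_iff.2 ha),
      chi_eq_of_isConj_incl (δ := jordan21 a₀ a₀) (by rw [mapGL_jordan21]; exact h.symm),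
      hs, classSize_jordan21_self, Nat.card_zmod, mul_one]
  · rw [ind_of_notMem (fun h0 => ha (mem_Fpow_one_iff.1 h0)), chi_eq_zero, mul_zero]
    intro δ hδ
    exact ha (pow_eq_of_isConj_incl hδ (by rw [← charpoly_eq_of_isConj h, charpoly_jordan21])).1

theorem parabolic2_class (hF : Nat.card F = p ^ n) {a : Fˣ} {γ : GL3 F}
    (h : IsConj (jordan3 a) γ) :
    classSize γ = sizeP2 (p ^ n) ∧
      chi p F γ = idx p F * ((sizeP2 p : ℂ) / (sizeP2 (p ^ n) : ℂ)) *
        ind (Fpow p 1 F) (a : F) := by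
  have hs : classSize γ = sizeP2 (p ^ n) := by
    rw [← classSize_eq_of_isConj h, classSize_jordan3, hF]
  refine ⟨hs, ?_⟩
  by_cases ha : (a : F) ^ p = a
  · obtain ⟨a₀, rfl⟩ := exists_units_map_eq ha
    rw [ind_of_mem (mem_Fpow_one_iff.2 ha),
      chi_eq_of_isConj_incl (δ := jordan3 a₀) (by rw [mapGL_jordan3]; exact h.symm),
      hs, classSize_jordan3, Nat.card_zmod, mul_one]
  · rw [ind_of_notMem (fun h0 => ha (mem_Fpow_one_iff.1 h0)), chi_eq_zero, mul_zero]
    intro δ hδ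
    exact ha (pow_eq_of_isConj_incl hδ (by rw [← charpoly_eq_of_isConj h, charpoly_jordan3])).1

theorem hyperbolic1_class (hF : Nat.card F = p ^ n) {a b : Fˣ} {γ : GL3 F} (hab : a ≠ b)
    (h : IsConj (diag3 ![a, a, b]) γ) :
    classSize γ = sizeH1 (p ^ n) ∧
      chi p F γ = idx p F * ((sizeH1 p : ℂ) / (sizeH1 (p ^ n) : ℂ)) *
        ind (Gam p F : Set (GL3 F)) (diag3 ![a, a, b]) := by
  have hs : classSize γ = sizeH1 (p ^ n) := by
    rw [← classSize_eq_of_isConj h, classSize_diag3_of_ne hab, hF]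
  refine ⟨hs, ?_⟩
  by_cases hδ : ∃ δ : GL3 (ZMod p), IsConj γ (incl p F δ)
  · obtain ⟨δ, hδ⟩ := hδ
    obtain ⟨ha, hb⟩ := pow_eq_of_isConj_incl hδ
      (by rw [← charpoly_eq_of_isConj h, charpoly_diag3])
    obtain ⟨a₀, rfl⟩ := exists_units_map_eq ha
    obtain ⟨b₀, rfl⟩ := exists_units_map_eq hb
    have hab₀ : a₀ ≠ b₀ := fun h0 => hab (h0 ▸ rfl)
    rw [← mapGL_diag3] at h ⊢
    rw [ind_of_mem (S := (Gam p F : Set (GL3 F))) (MonoidHom.mem_range.2 ⟨_, rfl⟩), chi_eq_of_isConj_incl h.symm, hs, classSize_diag3_of_ne hab₀,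
      Nat.card_zmod, mul_one]
  · rw [ind_of_notMem, chi_eq_zero (fun δ h0 => hδ ⟨δ, h0⟩), mul_zero]
    rintro ⟨δ, h0⟩
    exact hδ ⟨δ, h0 ▸ h.symm⟩

theorem parabolic3_class (hF : Nat.card F = p ^ n) {a b : Fˣ} {γ : GL3 F} (hab : a ≠ b)
    (h : IsConj (jordan21 a b) γ) :
    classSize γ = sizeP3 (p ^ n) ∧
      chi p F γ = idx p F * ((sizeP3 p : ℂ) / (sizeP3 (p ^ n) : ℂ)) *
        ind (Gam p F : Set (GL3 F)) (jordan21 a b) := by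
  have hs : classSize γ = sizeP3 (p ^ n) := by
    rw [← classSize_eq_of_isConj h, classSize_jordan21_of_ne hab, hF]
  refine ⟨hs, ?_⟩
  by_cases hδ : ∃ δ : GL3 (ZMod p), IsConj γ (incl p F δ)
  · obtain ⟨δ, hδ⟩ := hδ
    obtain ⟨ha, hb⟩ := pow_eq_of_isConj_incl hδ
      (by rw [← charpoly_eq_of_isConj h, charpoly_jordan21])
    obtain ⟨a₀, rfl⟩ := exists_units_map_eq ha
    obtain ⟨b₀, rfl⟩ := exists_units_map_eq hb
    have hab₀ : a₀ ≠ b₀ := fun h0 => hab (h0 ▸ rfl)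
    rw [← mapGL_jordan21] at h ⊢
    rw [ind_of_mem (S := (Gam p F : Set (GL3 F))) (MonoidHom.mem_range.2 ⟨_, rfl⟩), chi_eq_of_isConj_incl h.symm, hs, classSize_jordan21_of_ne hab₀,
      Nat.card_zmod, mul_one]
  · rw [ind_of_notMem, chi_eq_zero (fun δ h0 => hδ ⟨δ, h0⟩), mul_zero]
    rintro ⟨δ, h0⟩
    exact hδ ⟨δ, h0 ▸ h.symm⟩

section SecondHyperbolic

omit [Finite F] [Algebra (ZMod p) F] [Fact p.Prime] in
theorem cubic_comp_perm (d : Fin 3 → Fˣ) (σ : Equiv.Perm (Fin 3)) :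
    cubic (d (σ 0) : F) (d (σ 1)) (d (σ 2)) = cubic (d 0 : F) (d 1) (d 2) := by
  have h (d : Fin 3 → Fˣ) : cubic (d 0 : F) (d 1) (d 2) =
      ∏ i, (Polynomial.X - Polynomial.C (d i : F)) := by
    rw [Fin.prod_univ_three, cubic]
  rw [h d, ← Equiv.prod_comp σ, ← h fun i => d (σ i)]

omit [Finite F] in
theorem pow_p_injective {x y : F} (h : x ^ p = y ^ p) : x = y := by
  have := charP_of_algebra_zmod (p := p) (F := F)
  exact pow_pow_injective (p := p) (m := 1) (by simpa using h)

omit [Finite F] in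
theorem pow_ne_of_mem_cubicConj {d : Fin 3 → Fˣ} (h : d ∈ cubicConj p F) (i : Fin 3) :
    (d i : F) ^ p ≠ d i := by
  obtain ⟨σ, ⟨-, h0⟩, h1, h2⟩ := h
  rw [mem_Fpow_one_iff] at h0
  obtain ⟨j, rfl⟩ := σ.surjective i
  have h3 : ((d (σ 0) : F) ^ p) ^ p ≠ (d (σ 0) : F) ^ p := fun h => h0 (pow_p_injective h)
  fin_cases j
  · exact h0
  · simpa [h1] using h3
  · intro h
    apply h3
    simp only [Fin.reduceFinMk, h2, Units.val_pow_eq_pow_val, sq, pow_mul] at h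
    exact pow_p_injective h

omit [Finite F] in
theorem pow_eq_of_diag3_mem_Gam {d : Fin 3 → Fˣ} (h : diag3 d ∈ Gam p F) (i : Fin 3) :
    (d i : F) ^ p = d i := by
  have := charP_of_algebra_zmod (p := p) (F := F)
  obtain ⟨δ, hδ⟩ := h
  rw [← mem_range_zmod_iff (algebraMap (ZMod p) F)]
  refine ⟨δ.1 i i, ?_⟩
  have := congrArg (fun M : GL3 F => M.1 i i) hδ
  simpa [diag3, GeneralLinearGroup.mkOfDetNeZero] using this

omit [Finite F] in
theorem diag3_mem_Gam_of_pow_eq {a b c : Fˣ} (ha : (a : F) ^ p = a) (hb : (b : F) ^ p = b)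
    (hc : (c : F) ^ p = c) : diag3 ![a, b, c] ∈ Gam p F := by
  obtain ⟨a₀, rfl⟩ := exists_units_map_eq ha
  obtain ⟨b₀, rfl⟩ := exists_units_map_eq hb
  obtain ⟨c₀, rfl⟩ := exists_units_map_eq hc
  exact ⟨diag3 ![a₀, b₀, c₀], mapGL_diag3 _ _ _ _⟩

omit [Finite F] in
-- Frobenius permutes the three distinct eigenvalues: the identity gives Γ, a transposition
-- `quadConj`, a 3-cycle `cubicConj`.
theorem mem_of_cubic_pow_eq {a b c : Fˣ} (hab : a ≠ b) (hac : a ≠ c) (hbc : b ≠ c)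
    (h : cubic ((a : F) ^ p) ((b : F) ^ p) ((c : F) ^ p) = cubic (a : F) b c) :
    diag3 ![a, b, c] ∈ Gam p F ∨ ![a, b, c] ∈ quadConj p F ∨ ![a, b, c] ∈ cubicConj p F := by
  have hinj {x y : Fˣ} (hxy : x ≠ y) : (x : F) ^ p ≠ (y : F) ^ p :=
    fun h0 => hxy (Units.ext (pow_p_injective h0))
  have hne {x y : Fˣ} (hxy : x ≠ y) : (x : F) ≠ y := fun h0 => hxy (Units.ext h0)
  have h1 := hinj hab
  have h2 := hinj hac
  have h3 := hinj hbc
  have quad {x y z : Fˣ} (hxy : x ≠ y) (hx : (x : F) ^ p = y) (hy : (y : F) ^ p = x)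
      (hz : (z : F) ^ p = z) : ((x : F) ∈ Fpow p 2 F \ Fpow p 1 F ∧ y = x ^ p ∧
        (z : F) ∈ Fpow p 1 F) := by
    refine ⟨⟨?_, ?_⟩, ?_, mem_Fpow_one_iff.2 hz⟩
    · rw [Fpow, Set.mem_ofPred_eq, sq, pow_mul, hx, hy]
    · rw [mem_Fpow_one_iff, hx]
      exact (hne hxy).symm
    · exact Units.ext (by simp [hx])
  have cub {x y z : Fˣ} (hxy : x ≠ y) (hx : (x : F) ^ p = y) (hy : (y : F) ^ p = z)
      (hz : (z : F) ^ p = x) : ((x : F) ∈ Fpow p 3 F \ Fpow p 1 F ∧ y = x ^ p ∧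
        z = x ^ p ^ 2) := by
    refine ⟨⟨?_, ?_⟩, ?_, ?_⟩
    · rw [Fpow, Set.mem_ofPred_eq, show p ^ 3 = p * p * p by ring, pow_mul, pow_mul, hx, hy, hz]
    · rw [mem_Fpow_one_iff, hx]
      exact (hne hxy).symm
    · exact Units.ext (by simp [hx])
    · exact Units.ext (by rw [Units.val_pow_eq_pow_val, sq, pow_mul, hx, hy])
  have ha := eq_or_eq_or_eq_of_cubic_eq h
  have hb := eq_or_eq_or_eq_of_cubic_eq ((cubic_swap _ _ _).trans h)
  have hc := eq_or_eq_or_eq_of_cubic_eq ((cubic_rotate _ _ _).trans h)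
  -- Of the 27 maps from {a, b, c} to itself, injectivity leaves the six permutations. The witnesses
  -- `1`, `finRotate 3` and `Equiv.swap 1 2` reorder the triple into the required pattern.
  rcases ha with ha | ha | ha <;> rcases hb with hb | hb | hb <;> rcases hc with hc | hc | hc <;>
    first
    | exact absurd (ha.trans hb.symm) h1
    | exact absurd (ha.trans hc.symm) h2
    | exact absurd (hb.trans hc.symm) h3
    | skip
  · exact Or.inl (diag3_mem_Gam_of_pow_eq ha hb hc)
  · exact Or.inr (Or.inl ⟨finRotate 3, quad hbc hb hc ha⟩)
  · exact Or.inr (Or.inl ⟨1, quad hab ha hb hc⟩)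
  · exact Or.inr (Or.inr ⟨1, cub hab ha hb hc⟩)
  · exact Or.inr (Or.inr ⟨Equiv.swap 1 2, cub hac ha hc hb⟩)
  · exact Or.inr (Or.inl ⟨Equiv.swap 1 2, quad hac ha hc hb⟩)

end SecondHyperbolic

end

/-! ### The character on second hyperbolic and elliptic classes. -/

section

variable {p n : ℕ} [Fact p.Prime] {F : Type*} [Field F] [Algebra (ZMod p) F]

omit [Fact p.Prime] [Algebra (ZMod p) F] in
-- Separates this case from the other two: `cubicConj` has no eigenvalue in 𝔽_p, and Γ has only such
-- eigenvalues.
theorem pow_eq_of_mem_quadConj {d : Fin 3 → Fˣ} (h : d ∈ quadConj p F) :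
    (∃ i, (d i : F) ^ p = d i) ∧ ∃ i, (d i : F) ^ p ≠ d i := by
  obtain ⟨σ, ⟨-, h0⟩, -, h2⟩ := h
  rw [mem_Fpow_one_iff] at h0 h2
  exact ⟨⟨_, h2⟩, _, h0⟩

omit [Fact p.Prime] [Algebra (ZMod p) F] in
theorem cubic_pow_of_mem_cubicConj {d : Fin 3 → Fˣ} (h : d ∈ cubicConj p F) :
    cubic ((d 0 : F) ^ p) ((d 1 : F) ^ p) ((d 2 : F) ^ p) = cubic (d 0 : F) (d 1) (d 2) := by
  obtain ⟨σ, ⟨h0, -⟩, h1, h2⟩ := h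
  have h3 := cubic_comp_perm (fun i => d i ^ p) σ
  simp only [Units.val_pow_eq_pow_val] at h3
  have h4 : ((d (σ 0) : F) ^ p ^ 2) ^ p = d (σ 0) := by
    rw [← pow_mul, ← pow_succ]
    exact h0
  rw [← h3, ← cubic_comp_perm d σ, h1, h2, Units.val_pow_eq_pow_val, Units.val_pow_eq_pow_val, h4,
    ← pow_mul, ← sq]
  exact (cubic_rotate _ _ _).symm

omit [Fact p.Prime] [Algebra (ZMod p) F] in
theorem cubic_pow_of_mem_quadConj {d : Fin 3 → Fˣ} (h : d ∈ quadConj p F) :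
    cubic ((d 0 : F) ^ p) ((d 1 : F) ^ p) ((d 2 : F) ^ p) = cubic (d 0 : F) (d 1) (d 2) := by
  obtain ⟨σ, ⟨h0, -⟩, h1, h2⟩ := h
  have h3 := cubic_comp_perm (fun i => d i ^ p) σ
  simp only [Units.val_pow_eq_pow_val] at h3
  have h4 : ((d (σ 0) : F) ^ p) ^ p = d (σ 0) := by
    rw [← pow_mul, ← sq]
    exact h0
  rw [← h3, ← cubic_comp_perm d σ, h1, Units.val_pow_eq_pow_val, h4, mem_Fpow_one_iff.1 h2]
  exact cubic_swap _ _ _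

variable [Finite F]

/-- At most one indicator is nonzero. The number of eigenvalues outside 𝔽_p, three, two or none,
decides the type of the class in Γ and hence its size. -/
theorem hyperbolic2_class (hF : Nat.card F = p ^ n) {a b c : Fˣ} {γ : GL3 F} (hab : a ≠ b)
    (hac : a ≠ c) (hbc : b ≠ c) (h : IsConj (diag3 ![a, b, c]) γ) :
    classSize γ = sizeH2 (p ^ n) ∧
      chi p F γ = idx p F / (sizeH2 (p ^ n) : ℂ) *
        ((sizeE2 p : ℂ) * ind (cubicConj p F) ![a, b, c]
          + (sizeE1 p : ℂ) * ind (quadConj p F) ![a, b, c]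
          + (sizeH2 p : ℂ) * ind (Gam p F : Set (GL3 F)) (diag3 ![a, b, c])) := by
  have := charP_of_algebra_zmod (p := p) (F := F)
  have hs : classSize γ = sizeH2 (p ^ n) := by
    rw [← classSize_eq_of_isConj h, classSize_diag3_of_ne_of_ne hab hac hbc, hF]
  refine ⟨hs, ?_⟩
  have hcyc : HasCyclicVector γ.1 :=
    (hasCyclicVector_iff_of_isConj h).1 (hasCyclicVector_diag3 hab hac hbc)
  have hcp : γ.1.charpoly.map (RingHom.id F) = cubic (a : F) b c := by
    rw [Polynomial.map_id, ← charpoly_eq_of_isConj h, charpoly_diag3]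
  have hGam (hG : diag3 ![a, b, c] ∈ (Gam p F : Set (GL3 F))) (i : Fin 3) :
      (![a, b, c] i : F) ^ p = ![a, b, c] i := pow_eq_of_diag3_mem_Gam hG i
  by_cases hcub : ![a, b, c] ∈ cubicConj p F
  · have hne := pow_ne_of_mem_cubicConj hcub
    have hst : cubic ((a : F) ^ p) ((b : F) ^ p) ((c : F) ^ p) = cubic (a : F) b c := by
      simpa only [Matrix.cons_val] using cubic_pow_of_mem_cubicConj hcub
    have ha : (a : F) ^ p ≠ a := hne 0
    have hb : (b : F) ^ p ≠ b := hne 1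
    have hc : (c : F) ^ p ≠ c := hne 2
    obtain ⟨δ, hδ⟩ := exists_isConj_incl hcyc hcp hst
    have hsδ := classSize_of_charpoly_map_of_notMem (cubic_pow_of_isConj_incl hδ hcp).2
      (by rwa [mem_range_zmod_iff]) (by rwa [mem_range_zmod_iff]) (by rwa [mem_range_zmod_iff])
    rw [ind_of_mem hcub, ind_of_notMem (fun h0 => ?_),
      ind_of_notMem (fun h0 => hne 0 (hGam h0 0)), chi_eq_of_isConj_incl hδ, hs, hsδ,
      Nat.card_zmod]
    · ring
    · obtain ⟨⟨i, hi⟩, -⟩ := pow_eq_of_mem_quadConj h0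
      exact hne i hi
  by_cases hquad : ![a, b, c] ∈ quadConj p F
  · have hst : cubic ((a : F) ^ p) ((b : F) ^ p) ((c : F) ^ p) = cubic (a : F) b c := by
      simpa only [Matrix.cons_val] using cubic_pow_of_mem_quadConj hquad
    obtain ⟨δ, hδ⟩ := exists_isConj_incl hcyc hcp hst
    have hsδ : classSize δ = sizeE1 p := by
      have h1 := (cubic_pow_of_isConj_incl hδ hcp).2
      obtain ⟨σ, ⟨h2, h3⟩, h4, h5⟩ := id hquad
      have h6 := cubic_comp_perm ![a, b, c] σ
      rw [mem_Fpow_one_iff] at h3 h5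
      obtain ⟨r, hr⟩ := (mem_range_zmod_iff ((RingHom.id F).comp (algebraMap (ZMod p) F)) _).2 h5
      rw [← hr] at h6
      rw [classSize_of_charpoly_map_of_mem (h1.trans h6.symm), Nat.card_zmod]
      · rwa [mem_range_zmod_iff]
      · rw [mem_range_zmod_iff, h4, Units.val_pow_eq_pow_val]
        exact fun h0 => h3 (pow_p_injective h0)
    rw [ind_of_notMem hcub, ind_of_mem hquad, ind_of_notMem (fun h0 => ?_),
      chi_eq_of_isConj_incl hδ, hs, hsδ]
    · ring
    · obtain ⟨-, i, hi⟩ := pow_eq_of_mem_quadConj hquad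
      exact hi (hGam h0 i)
  by_cases hG : diag3 ![a, b, c] ∈ (Gam p F : Set (GL3 F))
  · rw [ind_of_notMem hcub, ind_of_notMem hquad, ind_of_mem hG]
    obtain ⟨a₀, rfl⟩ := exists_units_map_eq (hGam hG 0)
    obtain ⟨b₀, rfl⟩ := exists_units_map_eq (hGam hG 1)
    obtain ⟨c₀, rfl⟩ := exists_units_map_eq (hGam hG 2)
    rw [chi_eq_of_isConj_incl (δ := diag3 ![a₀, b₀, c₀]) (by rw [mapGL_diag3]; exact h.symm), hs,
      classSize_diag3_of_ne_of_ne (a := a₀) (b := b₀) (c := c₀) (fun h0 => hab (congrArg _ h0))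
        (fun h0 => hac (congrArg _ h0)) (fun h0 => hbc (congrArg _ h0)), Nat.card_zmod]
    ring
  · rw [ind_of_notMem hcub, ind_of_notMem hquad, ind_of_notMem hG, chi_eq_zero]
    · ring
    · intro δ hδ
      rcases mem_of_cubic_pow_eq hab hac hbc (cubic_pow_of_isConj_incl hδ hcp).1 with h0 | h0 | h0
      exacts [hG h0, hquad h0, hcub h0]

section Elliptic

variable {L : Type*} [Field L] [CharP L p]

omit [Fact p.Prime] [CharP L p] in
theorem pow_pow_comm (x : L) (m : ℕ) : (x ^ p ^ m) ^ p = (x ^ p) ^ p ^ m := by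
  rw [← pow_mul, ← pow_mul, mul_comm]

theorem pow_prime_injective {x y : L} (h : x ^ p = y ^ p) : x = y :=
  pow_pow_injective (p := p) (m := 1) (by simpa using h)

omit [Fact p.Prime] [CharP L p] in
theorem pow_pow_eq_of_pow_eq {x : L} (h : x ^ p = x) (m : ℕ) : x ^ p ^ m = x := by
  have := pow_pow_mul_eq_self (p := p) (a := 1) (by rwa [pow_one]) m
  rwa [one_mul] at this

/-- The eigenvalues of an element of the first elliptic type that is conjugate to a matrix over
the prime field. -/
theorem elliptic1_eigenvalues {w r : L} (hw : w ^ p ^ (2 * n) = w) (hw' : w ^ p ^ n ≠ w)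
    (hr : r ^ p ^ n = r)
    (h : cubic (w ^ p) ((w ^ p ^ n) ^ p) (r ^ p) = cubic w (w ^ p ^ n) r) :
    r ^ p = r ∧ w ^ p = w ^ p ^ n ∧ w ^ p ^ 2 = w := by
  have hww : (w ^ p ^ n) ^ p ^ n = w := by
    rw [← pow_mul, ← pow_add, ← two_mul, hw]
  have hrp : (r ^ p) ^ p ^ n = r ^ p := by rw [← pow_pow_comm, hr]
  -- The p-power and q-power maps commute, so r^p is fixed by the latter, while w and w^q are not.
  have h1 : r ^ p = r := by
    rcases eq_or_eq_or_eq_of_cubic_eq ((cubic_rotate _ _ _).trans h) with h1 | h1 | h1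
    · rw [h1] at hrp
      exact absurd hrp hw'
    · rw [h1, hww] at hrp
      exact absurd hrp.symm hw'
    · exact h1
  have h2 : w ^ p = w ^ p ^ n := by
    rcases eq_or_eq_or_eq_of_cubic_eq h with h2 | h2 | h2
    · exact absurd (pow_pow_eq_of_pow_eq h2 n) hw'
    · exact h2
    · rw [← h1] at h2
      rw [pow_prime_injective h2] at hw'
      exact absurd hr hw'
  refine ⟨h1, h2, ?_⟩
  rw [sq, pow_mul, h2, pow_pow_comm, h2, hww]

omit [Fact p.Prime] [CharP L p] in
-- Here w^p is w^q or w^(q²). As the two power maps commute, applying the p-power map three times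
-- gives w^(q³) or w^(q⁶), both equal to w.
theorem elliptic2_eigenvalues {w : L} (hw : w ^ p ^ (3 * n) = w) (hw' : w ^ p ^ n ≠ w)
    (h : cubic (w ^ p) ((w ^ p ^ n) ^ p) (((w ^ p ^ n) ^ p ^ n) ^ p) =
      cubic w (w ^ p ^ n) ((w ^ p ^ n) ^ p ^ n)) :
    w ^ p ≠ w ∧ w ^ p ^ 3 = w := by
  have hwww : ((w ^ p ^ n) ^ p ^ n) ^ p ^ n = w := by
    rw [← pow_mul, ← pow_mul, ← pow_add, ← pow_add]
    convert hw using 3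
    ring
  have h0 : w ^ p ≠ w := fun h2 => hw' (pow_pow_eq_of_pow_eq h2 n)
  refine ⟨h0, ?_⟩
  rw [show p ^ 3 = p * p * p by ring, pow_mul, pow_mul]
  rcases eq_or_eq_or_eq_of_cubic_eq h with h2 | h2 | h2
  · exact absurd h2 h0
  · rw [h2, pow_pow_comm, h2, pow_pow_comm, pow_pow_comm, h2, hwww]
  · have h3 : (w ^ p) ^ p = w ^ p ^ n := by
      rw [h2, pow_pow_comm, pow_pow_comm, h2, hwww]
    rw [h3, pow_pow_comm, h2, hwww]

omit [Fact p.Prime] [Algebra (ZMod p) F] [CharP L p] in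
theorem notMem_range_of_pow_ne (hF : Nat.card F = p ^ n) (g : F →+* L) {w : L}
    (hw : w ^ p ^ n ≠ w) : w ∉ g.range := by
  rwa [mem_range_iff_pow_natCard_eq, hF]

theorem elliptic1_class (hF : Nat.card F = p ^ n) (g : F →+* L) {γ : GL3 F} {w : L} {r : F}
    (hw : w ^ p ^ (2 * n) = w) (hw' : w ^ p ^ n ≠ w)
    (hγ : γ.1.charpoly.map g = cubic w (w ^ p ^ n) (g r)) :
    classSize γ = sizeE1 (p ^ n) ∧
      (2 ∣ n → chi p F γ = 0) ∧
      (¬ 2 ∣ n → chi p F γ = idx p F * ((sizeE1 p : ℂ) / (sizeE1 (p ^ n) : ℂ)) *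
        ind (Fpow p 2 L \ Fpow p 1 L) w * ind (Fpow p 1 F) r) := by
  have hr : g r ^ p ^ n = g r := by
    rw [← hF]
    exact (mem_range_iff_pow_natCard_eq g _).1 ⟨r, rfl⟩
  have hw'' : (w ^ p ^ n) ^ p ^ n ≠ w ^ p ^ n := fun h0 => hw' (pow_pow_injective h0)
  have hs : classSize γ = sizeE1 (p ^ n) := by
    rw [classSize_of_charpoly_map_of_mem hγ (notMem_range_of_pow_ne hF g hw')
      (notMem_range_of_pow_ne hF g hw''), hF]
  refine ⟨hs, ?_⟩
  by_cases hδ : ∃ δ : GL3 (ZMod p), IsConj γ (incl p F δ)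
  · obtain ⟨δ, hδ⟩ := hδ
    obtain ⟨h1, h2⟩ := cubic_pow_of_isConj_incl hδ hγ
    obtain ⟨h3, h4, h5⟩ := elliptic1_eigenvalues hw hw' hr h1
    have h6 : w ^ p ≠ w := by rwa [h4]
    have h7 : r ^ p = r := g.injective (by rw [map_pow, h3])
    refine ⟨?_, fun _ => ?_⟩
    -- For even n the q-power map is a power of x ↦ x^(p²), which fixes w; but w is not in F.
    · rintro ⟨m, rfl⟩
      exact absurd (pow_pow_mul_eq_self h5 m) hw'
    · have hsδ : classSize δ = sizeE1 p := by
        obtain ⟨r₀, hr₀⟩ := (mem_range_zmod_iff (g.comp (algebraMap (ZMod p) F)) _).2 h3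
        rw [← hr₀] at h2
        rw [classSize_of_charpoly_map_of_mem h2, Nat.card_zmod]
        · rwa [mem_range_zmod_iff]
        · rw [mem_range_zmod_iff, pow_pow_comm]
          exact fun h0 => h6 (pow_pow_injective h0)
      rw [ind_of_mem (S := Fpow p 2 L \ Fpow p 1 L) ⟨h5, by rwa [mem_Fpow_one_iff]⟩,
        ind_of_mem (mem_Fpow_one_iff.2 h7), chi_eq_of_isConj_incl hδ, hs, hsδ, mul_one, mul_one]
  · have h0 : chi p F γ = 0 := chi_eq_zero fun δ h0 => hδ ⟨δ, h0⟩
    refine ⟨fun _ => h0, fun hn => ?_⟩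
    rw [h0]
    by_cases h1 : w ∈ Fpow p 2 L \ Fpow p 1 L
    · by_cases h2 : r ∈ Fpow p 1 F
      · exfalso
        apply hδ
        rw [mem_Fpow_one_iff] at h2
        -- For odd n the q-power and p-power maps agree on 𝔽_{p²}, so the eigenvalues are stable
        -- under Frobenius and the class would meet Γ.
        have h3 : w ^ p ^ n = w ^ p := by
          obtain ⟨m, rfl⟩ := Nat.odd_iff.2 (Nat.two_dvd_ne_zero.1 hn)
          rw [pow_add, pow_one, pow_mul, pow_pow_mul_eq_self h1.1]
        have hne : w ≠ w ^ p ^ n := hw'.symm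
        have hne2 (x : L) (hx : x ^ p ^ n ≠ x) : x ≠ g r := by
          rintro rfl
          exact hx hr
        refine exists_isConj_incl (hasCyclicVector_of_charpoly_map hγ hne (hne2 _ hw')
          (hne2 _ hw'')) hγ ?_
        rw [← map_pow, h2, h3, ← pow_mul, ← sq, show w ^ p ^ 2 = w from h1.1]
        exact cubic_swap _ _ _
      · rw [ind_of_notMem h2, mul_zero]
    · rw [ind_of_notMem h1, mul_zero, zero_mul]

theorem elliptic2_class (hF : Nat.card F = p ^ n) (g : F →+* L) {γ : GL3 F} {w : L}
    (hw : w ^ p ^ (3 * n) = w) (hw' : w ^ p ^ n ≠ w)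
    (hγ : γ.1.charpoly.map g = cubic w (w ^ p ^ n) ((w ^ p ^ n) ^ p ^ n)) :
    classSize γ = sizeE2 (p ^ n) ∧
      (3 ∣ n → chi p F γ = 0) ∧
      (¬ 3 ∣ n → chi p F γ = idx p F * ((sizeE2 p : ℂ) / (sizeE2 (p ^ n) : ℂ)) *
        ind (Fpow p 3 L \ Fpow p 1 L) w) := by
  have hw2 : (w ^ p ^ n) ^ p ^ n ≠ w ^ p ^ n := fun h0 => hw' (pow_pow_injective h0)
  have hw3 : ((w ^ p ^ n) ^ p ^ n) ^ p ^ n ≠ (w ^ p ^ n) ^ p ^ n :=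
    fun h0 => hw2 (pow_pow_injective h0)
  have hwww : ((w ^ p ^ n) ^ p ^ n) ^ p ^ n = w := by
    rw [← pow_mul, ← pow_mul, ← pow_add, ← pow_add]
    convert hw using 3
    ring
  have hs : classSize γ = sizeE2 (p ^ n) := by
    rw [classSize_of_charpoly_map_of_notMem hγ (notMem_range_of_pow_ne hF g hw')
      (notMem_range_of_pow_ne hF g hw2) (notMem_range_of_pow_ne hF g hw3), hF]
  refine ⟨hs, ?_⟩
  by_cases hδ : ∃ δ : GL3 (ZMod p), IsConj γ (incl p F δ)
  · obtain ⟨δ, hδ⟩ := hδ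
    obtain ⟨h1, h2⟩ := cubic_pow_of_isConj_incl hδ hγ
    obtain ⟨h3, h4⟩ := elliptic2_eigenvalues hw hw' h1
    refine ⟨?_, fun _ => ?_⟩
    · rintro ⟨m, rfl⟩
      exact absurd (pow_pow_mul_eq_self h4 m) hw'
    · have hsδ : classSize δ = sizeE2 p := by
        have h5 {x : L} (hx : x ^ p ≠ x) : (x ^ p ^ n) ^ p ≠ x ^ p ^ n := by
          rw [pow_pow_comm]
          exact fun h0 => hx (pow_pow_injective h0)
        have h6 {x : L} (hx : x ^ p ≠ x) : x ∉ (g.comp (algebraMap (ZMod p) F)).range := by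
          rwa [mem_range_zmod_iff]
        rw [classSize_of_charpoly_map_of_notMem h2 (h6 h3) (h6 (h5 h3)) (h6 (h5 (h5 h3))),
          Nat.card_zmod]
      rw [ind_of_mem (S := Fpow p 3 L \ Fpow p 1 L) ⟨h4, by rwa [mem_Fpow_one_iff]⟩,
        chi_eq_of_isConj_incl hδ, hs, hsδ, mul_one]
  · have h0 : chi p F γ = 0 := chi_eq_zero fun δ h0 => hδ ⟨δ, h0⟩
    refine ⟨fun _ => h0, fun hn => ?_⟩
    rw [h0]
    by_cases h1 : w ∈ Fpow p 3 L \ Fpow p 1 L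
    · exfalso
      apply hδ
      refine exists_isConj_incl (hasCyclicVector_of_charpoly_map hγ hw'.symm ?_ hw2.symm) hγ ?_
      · intro h2
        rw [← h2] at hwww
        exact hw' hwww
      have h2 : ((w ^ p) ^ p) ^ p = w := by
        rw [← pow_mul, ← pow_mul]
        exact (congrArg (w ^ ·) (by ring)).trans h1.1
      -- On 𝔽_{p³} the q-power map is Frobenius or its square, so w, w^q, w^(q²) is the Frobenius
      -- orbit of w in one of its two cyclic orders.
      rcases (by omega : n % 3 = 1 ∨ n % 3 = 2) with hm | hm
      · have h3 : w ^ p ^ n = w ^ p := by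
          rw [show n = 3 * (n / 3) + 1 by omega, pow_add, pow_one, pow_mul,
            pow_pow_mul_eq_self h1.1]
        rw [h3, ← pow_pow_comm, h3, h2]
        exact (cubic_rotate _ _ _).symm
      · have h3 : w ^ p ^ n = (w ^ p) ^ p := by
          rw [show n = 3 * (n / 3) + 2 by omega, pow_add, pow_mul,
            pow_pow_mul_eq_self h1.1, sq, pow_mul]
        rw [h3, ← pow_pow_comm, ← pow_pow_comm, h3, h2]
        exact cubic_rotate _ _ _
    · rw [ind_of_notMem h1, mul_zero]

end Elliptic

end

/-! ### Every element belongs to one of the eight types. -/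

section

variable {p n : ℕ} [Fact p.Prime] {F : Type*} [Field F] [Finite F]

omit [Finite F] in
-- A cyclic matrix is determined by its characteristic polynomial, so only the coincidences among
-- the three eigenvalues matter.
theorem exists_type_of_splits {γ : GL3 F} (hc : HasCyclicVector γ.1) {x y z : F}
    (h : γ.1.charpoly = cubic x y z) :
    (∃ a b c : Fˣ, a ≠ b ∧ a ≠ c ∧ b ≠ c ∧ IsConj (diag3 ![a, b, c]) γ) ∨
      (∃ a : Fˣ, IsConj (jordan3 a) γ) ∨ (∃ a b : Fˣ, a ≠ b ∧ IsConj (jordan21 a b) γ) := by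
  obtain ⟨hx, hy, hz⟩ := ne_zero_of_charpoly_map_eq_cubic (i := RingHom.id F)
    (by rw [Polynomial.map_id, h])
  lift x to Fˣ using hx.isUnit
  lift y to Fˣ using hy.isUnit
  lift z to Fˣ using hz.isUnit
  have h21 {a b : Fˣ} (h : γ.1.charpoly = cubic (a : F) a b) :
      (∃ a : Fˣ, IsConj (jordan3 a) γ) ∨ (∃ a b : Fˣ, a ≠ b ∧ IsConj (jordan21 a b) γ) := by
    by_cases hab : a = b
    · subst hab
      exact Or.inl ⟨a, isConj_of_charpoly_eq (hasCyclicVector_jordan3 a) hc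
        (by rw [charpoly_jordan3, h])⟩
    · exact Or.inr ⟨a, b, hab, isConj_of_charpoly_eq (hasCyclicVector_jordan21 hab) hc
        (by rw [charpoly_jordan21, h])⟩
  by_cases hxy : x = y
  · subst hxy
    exact Or.inr (h21 h)
  by_cases hxz : x = z
  · subst hxz
    exact Or.inr (h21 (h.trans (cubic_swap_right _ _ _)))
  by_cases hyz : y = z
  · subst hyz
    exact Or.inr (h21 (h.trans (cubic_rotate _ _ _)))
  exact Or.inl ⟨x, y, z, hxy, hxz, hyz, isConj_of_charpoly_eq (hasCyclicVector_diag3 hxy hxz hyz)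
    hc (by rw [charpoly_diag3, h])⟩

theorem exists_isElliptic2 (hF : Nat.card F = p ^ n) [CharP (AlgebraicClosure F) p] {γ : GL3 F}
    (h : ∀ t, γ.1.charpoly.eval t ≠ 0) :
    ∃ w : (AlgebraicClosure F)ˣ, IsElliptic2 p n w γ := by
  obtain ⟨x, y, z, hxyz⟩ := exists_charpoly_map_eq γ (algebraMap F (AlgebraicClosure F))
  obtain ⟨w, hw, hw', hw'', hcp⟩ := exists_cubic_conjugates hF hxyz h
  obtain ⟨hw0, -, -⟩ := ne_zero_of_charpoly_map_eq_cubic hcp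
  lift w to (AlgebraicClosure F)ˣ using hw0.isUnit
  refine ⟨w, ⟨hw, hw'⟩, ?_⟩
  have h1 : ((w : AlgebraicClosure F) ^ p ^ n) ^ p ^ n ≠ (w : AlgebraicClosure F) ^ p ^ n :=
    fun h0 => hw' (pow_pow_injective h0)
  refine isConj_of_charpoly_eq (hasCyclicVector_diag3 ?_ ?_ ?_)
    (hasCyclicVector_mapGL (hasCyclicVector_of_eval_ne_zero h)) ?_
  · exact fun h0 => hw' (by simpa using (congrArg Units.val h0).symm)
  · exact fun h0 => hw'' (by simpa [sq, pow_mul] using (congrArg Units.val h0).symm)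
  · exact fun h0 => h1 (by simpa [sq, pow_mul] using (congrArg Units.val h0).symm)
  · rw [charpoly_mapGL, hcp, charpoly_diag3, Units.val_pow_eq_pow_val, Units.val_pow_eq_pow_val, sq, pow_mul]

theorem exists_isElliptic1 (hF : Nat.card F = p ^ n) [CharP (AlgebraicClosure F) p] {γ : GL3 F}
    {r : F} {f : Polynomial F} (h : γ.1.charpoly = (Polynomial.X - Polynomial.C r) * f)
    (hf : ∀ t, f.eval t ≠ 0) :
    ∃ (w : (AlgebraicClosure F)ˣ) (r : Fˣ), IsElliptic1 p n w r γ := by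
  set g := algebraMap F (AlgebraicClosure F) with hg
  obtain ⟨x, y, hxy⟩ : ∃ x y, γ.1.charpoly.map g = cubic x y (g r) := by
    obtain ⟨x, y, z, hxyz⟩ := exists_charpoly_map_eq γ g
    have h1 : (γ.1.charpoly.map g).eval (g r) = 0 := by
      rw [Polynomial.eval_map_apply, h]
      simp
    rw [hxyz, eval_cubic] at h1
    simp only [mul_eq_zero, sub_eq_zero] at h1
    rcases h1 with (h1 | h1) | h1
    · exact ⟨y, z, by rw [hxyz, h1, cubic_rotate]⟩
    · exact ⟨x, z, by rw [hxyz, h1, cubic_swap_right]⟩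
    · exact ⟨x, y, by rw [hxyz, h1]⟩
  obtain ⟨hw, hw', rfl⟩ := exists_quadratic_conjugates hF (h ▸ hxy) hf
  obtain ⟨hx, -, hr⟩ := ne_zero_of_charpoly_map_eq_cubic hxy
  lift x to (AlgebraicClosure F)ˣ using hx.isUnit
  lift r to Fˣ using ((map_ne_zero g).1 hr).isUnit
  have hr2 : g r ^ p ^ n = g r := by
    rw [← hF]
    exact (mem_range_iff_pow_natCard_eq g _).1 ⟨r, rfl⟩
  have hne {t : AlgebraicClosure F} (ht : t ^ p ^ n ≠ t) : t ≠ g r := by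
    rintro rfl
    exact ht hr2
  have h1 : ((x : AlgebraicClosure F) ^ p ^ n) ^ p ^ n ≠ (x : AlgebraicClosure F) ^ p ^ n :=
    fun h0 => hw' (pow_pow_injective h0)
  refine ⟨x, r, ⟨hw, hw'⟩, isConj_of_charpoly_eq (hasCyclicVector_diag3 ?_ ?_ ?_)
    (hasCyclicVector_mapGL (hasCyclicVector_of_charpoly_eq_mul h hf)) ?_⟩
  · exact fun h0 => hw' (by simpa using (congrArg Units.val h0).symm)
  · exact fun h0 => hne hw' (congrArg Units.val h0)
  · exact fun h0 => hne h1 (congrArg Units.val h0)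
  · rw [charpoly_mapGL, hxy, charpoly_diag3]
    rfl

/-- Every element of `GL₃(F)` belongs to one of the eight types of classes. -/
theorem exists_type (hF : Nat.card F = p ^ n) [CharP (AlgebraicClosure F) p] (γ : GL3 F) :
    (∃ a : Fˣ, IsConj (diag3 ![a, a, a]) γ) ∨
      (∃ a b : Fˣ, a ≠ b ∧ IsConj (diag3 ![a, a, b]) γ) ∨
      (∃ a b c : Fˣ, a ≠ b ∧ a ≠ c ∧ b ≠ c ∧ IsConj (diag3 ![a, b, c]) γ) ∨
      (∃ a : Fˣ, IsConj (jordan21 a a) γ) ∨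
      (∃ a : Fˣ, IsConj (jordan3 a) γ) ∨
      (∃ a b : Fˣ, a ≠ b ∧ IsConj (jordan21 a b) γ) ∨
      (∃ (w : (AlgebraicClosure F)ˣ) (r : Fˣ), IsElliptic1 p n w r γ) ∨
      (∃ w : (AlgebraicClosure F)ˣ, IsElliptic2 p n w γ) := by
  by_cases hc : HasCyclicVector γ.1
  -- Without a root in F the class is second elliptic; if removing one root leaves no further root
  -- it is first elliptic. With two roots the remaining monic factor is linear, so the polynomial
  -- splits.
  · by_cases h : ∀ t, γ.1.charpoly.eval t ≠ 0
    · exact Or.inr (Or.inr (Or.inr (Or.inr (Or.inr (Or.inr (Or.inr (exists_isElliptic2 hF h)))))))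
    push Not at h
    obtain ⟨r, hr⟩ := h
    obtain ⟨f, hf⟩ := Polynomial.dvd_iff_isRoot.2 hr
    by_cases h : ∀ t, f.eval t ≠ 0
    · exact Or.inr (Or.inr (Or.inr (Or.inr (Or.inr (Or.inr (Or.inl
        (exists_isElliptic1 hF hf h)))))))
    push Not at h
    obtain ⟨s, hs⟩ := h
    obtain ⟨l, rfl⟩ := Polynomial.dvd_iff_isRoot.2 hs
    have hmon : l.Monic := Polynomial.Monic.of_mul_monic_left
      ((Polynomial.monic_X_sub_C r).mul (Polynomial.monic_X_sub_C s))
      (by rw [mul_assoc, ← hf]; exact γ.1.charpoly_monic)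
    have hdeg : l.natDegree = 1 := by
      have := natDegree_charpoly_fin_three γ.1
      rw [hf, ← mul_assoc, ((Polynomial.monic_X_sub_C r).mul
        (Polynomial.monic_X_sub_C s)).natDegree_mul hmon,
        (Polynomial.monic_X_sub_C r).natDegree_mul (Polynomial.monic_X_sub_C s),
        Polynomial.natDegree_X_sub_C, Polynomial.natDegree_X_sub_C] at this
      omega
    have hl : l = Polynomial.X - Polynomial.C (-l.coeff 0) := by
      rw [map_neg, sub_neg_eq_add]
      exact hmon.eq_X_add_C hdeg
    rw [hl, ← mul_assoc] at hf
    rcases exists_type_of_splits hc hf with h | h | h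
    · exact Or.inr (Or.inr (Or.inl h))
    · exact Or.inr (Or.inr (Or.inr (Or.inr (Or.inl h))))
    · exact Or.inr (Or.inr (Or.inr (Or.inr (Or.inr (Or.inl h)))))
  · rcases isConj_standard_of_not_hasCyclicVector hc with ⟨a, b, h⟩ | h
    · by_cases hab : a = b
      · subst hab
        exact Or.inl ⟨a, h⟩
      · exact Or.inr (Or.inl ⟨a, b, hab, h⟩)
    · exact Or.inr (Or.inr (Or.inr (Or.inl h)))

end

end GL3Char

end

open GL3Char
theorem mainTheorem3 (p n : ℕ) [Fact p.Prime] (F : Type*) [Field F] [Finite F]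
    [Algebra (ZMod p) F] (hF : Nat.card F = p ^ n) :
    -- every element of `GL₃(F)` belongs to one of the eight types of classes
    (∀ γ : GL3 F,
      (∃ a : Fˣ, IsConj (diag3 ![a, a, a]) γ) ∨
      (∃ a b : Fˣ, a ≠ b ∧ IsConj (diag3 ![a, a, b]) γ) ∨
      (∃ a b c : Fˣ, a ≠ b ∧ a ≠ c ∧ b ≠ c ∧ IsConj (diag3 ![a, b, c]) γ) ∨
      (∃ a : Fˣ, IsConj (jordan21 a a) γ) ∨
      (∃ a : Fˣ, IsConj (jordan3 a) γ) ∨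
      (∃ a b : Fˣ, a ≠ b ∧ IsConj (jordan21 a b) γ) ∨
      (∃ (w : (AlgebraicClosure F)ˣ) (r : Fˣ), IsElliptic1 p n w r γ) ∨
      (∃ w : (AlgebraicClosure F)ˣ, IsElliptic2 p n w γ)) ∧
    -- central classes
    (∀ (a : Fˣ) (γ : GL3 F), IsConj (diag3 ![a, a, a]) γ →
      classSize γ = 1 ∧
      chi p F γ = idx p F * ind (Fpow p 1 F) (a : F)) ∧
    -- first hyperbolic classes
    (∀ (a b : Fˣ) (γ : GL3 F), a ≠ b → IsConj (diag3 ![a, a, b]) γ →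
      classSize γ = sizeH1 (p ^ n) ∧
      chi p F γ = idx p F * ((sizeH1 p : ℂ) / (sizeH1 (p ^ n) : ℂ)) *
        ind (Gam p F : Set (GL3 F)) (diag3 ![a, a, b])) ∧
    -- second hyperbolic classes
    (∀ (a b c : Fˣ) (γ : GL3 F), a ≠ b → a ≠ c → b ≠ c → IsConj (diag3 ![a, b, c]) γ →
      classSize γ = sizeH2 (p ^ n) ∧
      chi p F γ = idx p F / (sizeH2 (p ^ n) : ℂ) *
        ((sizeE2 p : ℂ) * ind (cubicConj p F) ![a, b, c]
          + (sizeE1 p : ℂ) * ind (quadConj p F) ![a, b, c]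
          + (sizeH2 p : ℂ) * ind (Gam p F : Set (GL3 F)) (diag3 ![a, b, c]))) ∧
    -- first parabolic classes
    (∀ (a : Fˣ) (γ : GL3 F), IsConj (jordan21 a a) γ →
      classSize γ = sizeP1 (p ^ n) ∧
      chi p F γ = idx p F * ((sizeP1 p : ℂ) / (sizeP1 (p ^ n) : ℂ)) *
        ind (Fpow p 1 F) (a : F)) ∧
    -- second parabolic classes
    (∀ (a : Fˣ) (γ : GL3 F), IsConj (jordan3 a) γ →
      classSize γ = sizeP2 (p ^ n) ∧
      chi p F γ = idx p F * ((sizeP2 p : ℂ) / (sizeP2 (p ^ n) : ℂ)) *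
        ind (Fpow p 1 F) (a : F)) ∧
    -- third parabolic classes
    (∀ (a b : Fˣ) (γ : GL3 F), a ≠ b → IsConj (jordan21 a b) γ →
      classSize γ = sizeP3 (p ^ n) ∧
      chi p F γ = idx p F * ((sizeP3 p : ℂ) / (sizeP3 (p ^ n) : ℂ)) *
        ind (Gam p F : Set (GL3 F)) (jordan21 a b)) ∧
    -- first elliptic classes
    (∀ (w : (AlgebraicClosure F)ˣ) (r : Fˣ) (γ : GL3 F), IsElliptic1 p n w r γ →
      classSize γ = sizeE1 (p ^ n) ∧
      (2 ∣ n → chi p F γ = 0) ∧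
      (¬ 2 ∣ n → chi p F γ = idx p F * ((sizeE1 p : ℂ) / (sizeE1 (p ^ n) : ℂ)) *
        ind (Fpow p 2 (AlgebraicClosure F) \ Fpow p 1 (AlgebraicClosure F))
          (w : AlgebraicClosure F) *
        ind (Fpow p 1 F) (r : F))) ∧
    -- second elliptic classes
    (∀ (w : (AlgebraicClosure F)ˣ) (γ : GL3 F), IsElliptic2 p n w γ →
      classSize γ = sizeE2 (p ^ n) ∧
      (3 ∣ n → chi p F γ = 0) ∧
      (¬ 3 ∣ n → chi p F γ = idx p F * ((sizeE2 p : ℂ) / (sizeE2 (p ^ n) : ℂ)) *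
        ind (Fpow p 3 (AlgebraicClosure F) \ Fpow p 1 (AlgebraicClosure F))
          (w : AlgebraicClosure F))) := by
  have := charP_of_algebra_zmod (p := p) (F := F)
  have : CharP (AlgebraicClosure F) p :=
    charP_of_injective_algebraMap (algebraMap F (AlgebraicClosure F)).injective p
  refine ⟨exists_type hF, fun a γ => central_class, fun a b γ => hyperbolic1_class hF,
    fun a b c γ => hyperbolic2_class hF, fun a γ => parabolic1_class hF,
    fun a γ => parabolic2_class hF, fun a b γ => parabolic3_class hF, ?_, ?_⟩
  · rintro w r γ ⟨⟨hw, hw'⟩, hc⟩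
    refine elliptic1_class hF (algebraMap F (AlgebraicClosure F)) hw hw' ?_
    rw [← charpoly_mapGL, ← charpoly_eq_of_isConj hc, charpoly_diag3]
    rfl
  · rintro w γ ⟨⟨hw, hw'⟩, hc⟩
    refine elliptic2_class hF (algebraMap F (AlgebraicClosure F)) hw hw' ?_
    rw [← charpoly_mapGL, ← charpoly_eq_of_isConj hc, charpoly_diag3, Units.val_pow_eq_pow_val,
      Units.val_pow_eq_pow_val, sq, pow_mul]
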